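/- Let $n\ge 1$ be an integer, $s\in(0,1)$, $p>1$ with $n>sp$, and let $\Omega\subset\mathbb R^n$ be a bounded open set. For measurable $u:\mathbb R^n\to\mathbb R$, $x_0\in\mathbb R^n$ and $R>0$ put $$[u]_{W^{s,p}(S)}:=\Big(\int_S\int_S\frac{|u(x)-u(y)|^p}{|x-y|^{n+sp}}\,dx\,dy\Big)^{1/p},\qquad \mathrm{Tail}_{s,p}(u;x_0,R):=\Big(R^{sp}\int_{\mathbb R^n\setminus B_R(x_0)}\frac{|u(x)|^{p-1}}{|x-x_0|^{n+sp}}\,dx\Big)^{\frac1{p-1}},$$ and $\overline{\mathrm{Tail}}_{s,p}(u;x_0,R):=R^{-\frac{sp}{p-1}}\,\mathrm{Tail}_{s,p}(u;x_0,R)$. Write $v_+=\max\{v,0\}$ and $v_-=\max\{-v,0\}$. For $d,\lambda\ge0$ and $H\ge1$, the class $\mathrm{DG}_\pm(\Omega;d,H,\lambda)$ consists of the measurable functions $u:\mathbb R^n\to\mathbb R$ with $\int_{\mathbb R^n}\frac{|u(x)|^{p-1}}{(1+|x|)^{n+sp}}\,dx<\infty$, $u\in L^p(\Omega)$ and $[u]_{W^{s,p}(\Omega)}<\infty$,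 such that, for every $x_0\in\Omega$, $0<r<R<\mathrm{dist}(x_0,\partial\Omega)$ and $k\in\mathbb R$, $$\begin{aligned}&[(u-k)_\pm]_{W^{s,p}(B_r(x_0))}^p+\int_{B_r(x_0)}(u(x)-k)_\pm\Big\{\int_{\mathbb R^n}\frac{(u(y)-k)_\mp^{p-1}}{|x-y|^{n+sp}}\,dy\Big\}dx\\ &\quad\le H\Big\{R^\lambda d^p\,|A^\pm|+\frac{R^{(1-s)p}}{(R-r)^p}\|(u-k)_\pm\|_{L^p(B_R(x_0))}^p\\ &\qquad\quad+\frac{R^{n+sp}}{(R-r)^{n+sp}}\|(u-k)_\pm\|_{L^1(B_R(x_0))}\,\overline{\mathrm{Tail}}_{s,p}((u-k)_\pm;x_0,r)^{p-1}\Big\},\end{aligned}$$ where $A^+=B_R(x_0)\cap\{u>k\}$ and $A^-=B_R(x_0)\cap\{u<k\}$. Put $\mathrm{DG}(\Omega;d,H,\lambda):=\mathrm{DG}_+(\Omega;d,H,\lambda)\cap\mathrm{DG}_-(\Omega;d,H,\lambda)$. **Theorem (Hölder continuity of functions in DG).** There exist $\alpha\in(0,1)$ and $C\ge1$, depending only on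 $n,s,p,H,\lambda$, such that every $u\in\mathrm{DG}(\Omega;d,H,\lambda)$, after modification on a subset of $\Omega$ of measure zero, belongs to $C^\alpha_{\mathrm{loc}}(\Omega)$ (that is, $u$ is $\alpha$-Hölder continuous on every compact subset of $\Omega$) and satisfies $$[u]_{C^\alpha(B_R(x_0))}\le\frac{C}{R^\alpha}\Big(\|u\|_{L^\infty(B_{2R}(x_0))}+\mathrm{Tail}_{s,p}(u;x_0,2R)+R^{\frac{\lambda+sp}{p}}d\Big)$$ for every $x_0\in\Omega$ and $0<R<\mathrm{dist}(x_0,\partial\Omega)/2$, where $[u]_{C^\alpha(S)}:=\sup_{x\ne y\in S}|u(x)-u(y)|/|x-y|^\alpha$. -/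

import Mathlib

open MeasureTheory Set Metric
open scoped ENNReal

/-- Euclidean space of dimension `n`. -/
abbrev FracDG.E (n : ℕ) : Type := EuclideanSpace ℝ (Fin n)

namespace FracDG

noncomputable section

/-- The Gagliardo seminorm `[u]_{W^{s,p}(S)}`, with values in `[0, ∞]`. (The real quotient is `0`
on the diagonal, a null set.) -/
def gagliardoSeminorm {n : ℕ} (s p : ℝ) (u : E n → ℝ) (S : Set (E n)) : ℝ≥0∞ :=
  (∫⁻ x in S, ∫⁻ y in S,
    ENNReal.ofReal (|u x - u y| ^ p / ‖x - y‖ ^ ((n : ℝ) + s * p))) ^ (1 / p)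

/-- The restriction of `u` to `Ω` lies in the fractional Sobolev space `W^{s,p}(Ω)`. -/
def MemW {n : ℕ} (s p : ℝ) (u : E n → ℝ) (Ω : Set (E n)) : Prop :=
  MemLp u (ENNReal.ofReal p) (volume.restrict Ω) ∧ gagliardoSeminorm s p u Ω < ∞

/-- The weighted Lebesgue space `L^{p-1}_s(ℝⁿ)`; "measurable" is Lebesgue measurable. -/
def MemWeightedL {n : ℕ} (s p : ℝ) (u : E n → ℝ) : Prop :=
  AEMeasurable u volume ∧
    ∫⁻ x, ENNReal.ofReal (|u x| ^ (p - 1) / (1 + ‖x‖) ^ ((n : ℝ) + s * p)) < ∞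

/-- `Tail_{s,p}(u; x₀, R)`. -/
def tail {n : ℕ} (s p : ℝ) (u : E n → ℝ) (x₀ : E n) (R : ℝ) : ℝ≥0∞ :=
  (ENNReal.ofReal (R ^ (s * p)) *
    ∫⁻ x in (ball x₀ R)ᶜ,
      ENNReal.ofReal (|u x| ^ (p - 1) / ‖x - x₀‖ ^ ((n : ℝ) + s * p))) ^ (1 / (p - 1))

/-- The rescaled tail `R^{-sp/(p-1)} Tail_{s,p}(u; x₀, R)`. -/
def tailBar {n : ℕ} (s p : ℝ) (u : E n → ℝ) (x₀ : E n) (R : ℝ) : ℝ≥0∞ :=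
  ENNReal.ofReal (R ^ (-(s * p / (p - 1)))) * tail s p u x₀ R

/-- The strong Caccioppoli inequality on `B_r(x₀) ⊂ B_R(x₀)`. It is used with
`w = (u - k)_±`, `v = (u - k)_∓` and `A = A^±(k)`. -/
def StrongCaccioppoli {n : ℕ} (s p d H lam : ℝ) (w v : E n → ℝ) (A : Set (E n))
    (x₀ : E n) (r R : ℝ) : Prop :=
  gagliardoSeminorm s p w (ball x₀ r) ^ p
      + ∫⁻ x in ball x₀ r, ENNReal.ofReal (w x) *
          ∫⁻ y, ENNReal.ofReal (v y ^ (p - 1) / ‖x - y‖ ^ ((n : ℝ) + s * p))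
    ≤ ENNReal.ofReal H *
      (ENNReal.ofReal (R ^ lam * d ^ p) * volume (A ∩ ball x₀ R)
        + ENNReal.ofReal (R ^ ((1 - s) * p) / (R - r) ^ p)
            * eLpNorm w (ENNReal.ofReal p) (volume.restrict (ball x₀ R)) ^ p
        + ENNReal.ofReal (R ^ ((n : ℝ) + s * p) / (R - r) ^ ((n : ℝ) + s * p))
            * eLpNorm w 1 (volume.restrict (ball x₀ R)) * tailBar s p w x₀ r ^ (p - 1))

/-- The class `DG^{s,p}_+(Ω; d, H, λ)`. -/
def DGPlus {n : ℕ} (s p d H lam : ℝ) (Ω : Set (E n)) : Set (E n → ℝ) :=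
  {u | MemWeightedL s p u ∧ MemW s p u Ω ∧
    ∀ x₀ ∈ Ω, ∀ r R : ℝ, 0 < r → r < R → R < infDist x₀ (frontier Ω) → ∀ k : ℝ,
      StrongCaccioppoli s p d H lam (fun x => (u x - k)⁺) (fun x => (u x - k)⁻)
        {x | k < u x} x₀ r R}

/-- The class `DG^{s,p}_-(Ω; d, H, λ)`. -/
def DGMinus {n : ℕ} (s p d H lam : ℝ) (Ω : Set (E n)) : Set (E n → ℝ) :=
  {u | MemWeightedL s p u ∧ MemW s p u Ω ∧
    ∀ x₀ ∈ Ω, ∀ r R : ℝ, 0 < r → r < R → R < infDist x₀ (frontier Ω) → ∀ k : ℝ,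
      StrongCaccioppoli s p d H lam (fun x => (u x - k)⁻) (fun x => (u x - k)⁺)
        {x | u x < k} x₀ r R}

/-- The strong fractional De Giorgi class `DG^{s,p}(Ω; d, H, λ)`. -/
def DG {n : ℕ} (s p d H lam : ℝ) (Ω : Set (E n)) : Set (E n → ℝ) :=
  DGPlus s p d H lam Ω ∩ DGMinus s p d H lam Ω

/-- The Hölder seminorm `[u]_{C^α(S)}`, with values in `[0, ∞]` (the real quotient is `0` for
`x = y`, so those pairs do not contribute). -/
def holderSeminorm {n : ℕ} (α : ℝ) (u : E n → ℝ) (S : Set (E n)) : ℝ≥0∞ :=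
  ⨆ x ∈ S, ⨆ y ∈ S, ENNReal.ofReal (|u x - u y| / ‖x - y‖ ^ α)

/-- `u ∈ C^α_loc(Ω)`: finite Hölder seminorm on each compact subset of `Ω` (for `α > 0` this
entails continuity, hence boundedness, on each such subset). -/
def LocHolder {n : ℕ} (α : ℝ) (u : E n → ℝ) (Ω : Set (E n)) : Prop :=
  ∀ K ⊆ Ω, IsCompact K → holderSeminorm α u K < ∞

end

end FracDG

/-! This is De Giorgi's method, with the interaction term of the strong Caccioppoli inequality
replacing the usual isoperimetric or logarithmic argument. Since `-u` satisfies the same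
inequalities as `u`, only superlevel sets need to be treated.

Smallness implies boundedness (`exists_iteration_threshold`). Caccioppoli bounds the energy of a
truncation by its `L^p` excess at a lower level on a larger ball. In the other direction, a function
that vanishes on a fixed part of every ball of radius `ρ` has its `L^p` norm bounded by `ρ^{sp}`
times its energy (`lintegral_rpow_le_energy`). A smaller excess makes the superlevel sets smaller,
which allows a smaller `ρ`; the excess therefore decays geometrically and vanishes in the limit.

Growth (`exists_growth`). Let `f ≤ M` on `B_ρ` and let `f ≤ M - ω/2` on half of `B_{ρ/2}`. At the
level `k = M - δω` the interaction term is at least about `ω^{p-1} ρ^{-sp} ∫ (f-k)_+`, while the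
right side of the Caccioppoli inequality is at most about `(δω)^p ρ^{n-sp}`. As `(f-k)_+ ≤ δω`, the
`L^p` excess is at most `C δ^{p-1} (δω)^p ρ^n`. For small `δ` this is below the threshold of the
iteration, so `f ≤ M - δω/2` on `B_{ρ/4}`.

Oscillation decay (`exists_oscillation_decay`). At each scale `u` lies on one side of the midpoint
of its range on half of the ball, so the growth lemma applies to `u` or to `-u`, and the oscillation
shrinks by `4^{-α}` when the radius shrinks by `4`. Nonlocality enters through the tail of the
excess: earlier steps bound that excess at distance `t` by `ω((4t/ρ)^α - 1)`, whose kernel integral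
is small for small `α`.

The decay holds around every point of a ball, with almost everywhere bounds. Limits of averages turn
these into pointwise bounds, hence into a Hölder estimate. Local boundedness (`Cacc.exists_ae_le`)
makes the right side of that estimate finite. -/

namespace FracDG

noncomputable section

variable {n : ℕ} {s p d H lam : ℝ}

/-! ### Caccioppoli inequalities in integral form -/

/-- The double integral whose `1 / p`-th power is the Gagliardo seminorm. -/
def energy (s p : ℝ) (w : E n → ℝ) (S : Set (E n)) : ℝ≥0∞ :=
  ∫⁻ x in S, ∫⁻ y in S, ENNReal.ofReal (|w x - w y| ^ p / ‖x - y‖ ^ ((n : ℝ) + s * p))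

/-- The integral of `|w|^{p-1} |x - x₀|^{-n-sp}` over the complement of `B_r(x₀)`. -/
def tailInt (s p : ℝ) (w : E n → ℝ) (x₀ : E n) (r : ℝ) : ℝ≥0∞ :=
  ∫⁻ x in (ball x₀ r)ᶜ, ENNReal.ofReal (|w x| ^ (p - 1) / ‖x - x₀‖ ^ ((n : ℝ) + s * p))

/-- The interaction term `∫_S w ∫ v^{p-1} |x - y|^{-n-sp}`. -/
def interaction (s p : ℝ) (w v : E n → ℝ) (S : Set (E n)) : ℝ≥0∞ :=
  ∫⁻ x in S, ENNReal.ofReal (w x) *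
    ∫⁻ y, ENNReal.ofReal (v y ^ (p - 1) / ‖x - y‖ ^ ((n : ℝ) + s * p))

/-- All strong Caccioppoli inequalities for the superlevel sets of `f` on balls centred at `x₀`
and of radius at most `ρ`, in terms of integrals. -/
def Cacc (s p d H lam : ℝ) (f : E n → ℝ) (x₀ : E n) (ρ : ℝ) : Prop :=
  ∀ r R : ℝ, 0 < r → r < R → R ≤ ρ → ∀ k : ℝ,
    energy s p (fun x => (f x - k)⁺) (ball x₀ r)
      + interaction s p (fun x => (f x - k)⁺) (fun x => (f x - k)⁻) (ball x₀ r)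
    ≤ ENNReal.ofReal H *
      (ENNReal.ofReal (R ^ lam * d ^ p) * volume ({x | k < f x} ∩ ball x₀ R)
        + ENNReal.ofReal (R ^ ((1 - s) * p) / (R - r) ^ p)
            * (∫⁻ x in ball x₀ R, ENNReal.ofReal ((f x - k)⁺ ^ p))
        + ENNReal.ofReal (R ^ ((n : ℝ) + s * p) / (R - r) ^ ((n : ℝ) + s * p))
            * (∫⁻ x in ball x₀ R, ENNReal.ofReal ((f x - k)⁺))
            * tailInt s p (fun x => (f x - k)⁺) x₀ r)

theorem gagliardoSeminorm_rpow (hp : 1 < p) (w : E n → ℝ) (S : Set (E n)) :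
    gagliardoSeminorm s p w S ^ p = energy s p w S := by
  rw [gagliardoSeminorm, ← ENNReal.rpow_mul, one_div_mul_cancel (by linarith), ENNReal.rpow_one]
  rfl

theorem tail_rpow (hp : 1 < p) (w : E n → ℝ) (x₀ : E n) (r : ℝ) :
    tail s p w x₀ r ^ (p - 1) = ENNReal.ofReal (r ^ (s * p)) * tailInt s p w x₀ r := by
  rw [tail, ← ENNReal.rpow_mul, one_div_mul_cancel (by linarith), ENNReal.rpow_one]
  rfl

/-- The normalising power of `r` in `tailBar` cancels the factor `r^{sp}` of `tail`, so only the
bare tail integral enters the Caccioppoli inequality. -/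
theorem tailBar_rpow (hp : 1 < p) (w : E n → ℝ) (x₀ : E n) {r : ℝ} (hr : 0 < r) :
    tailBar s p w x₀ r ^ (p - 1) = tailInt s p w x₀ r := by
  have h1 : (0 : ℝ) < p - 1 := by linarith
  rw [tailBar, ENNReal.mul_rpow_of_nonneg _ _ h1.le, tail_rpow hp,
    ENNReal.ofReal_rpow_of_pos (by positivity), ← Real.rpow_mul hr.le, ← mul_assoc,
    ← ENNReal.ofReal_mul (by positivity), ← Real.rpow_add hr]
  rw [show -(s * p / (p - 1)) * (p - 1) + s * p = 0 by field_simp; ring]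
  simp

theorem eLpNorm_rpow_of_nonneg (hp : 1 < p) {w : E n → ℝ} (hw : ∀ x, 0 ≤ w x) (S : Set (E n)) :
    eLpNorm w (ENNReal.ofReal p) (volume.restrict S) ^ p
      = ∫⁻ x in S, ENNReal.ofReal (w x ^ p) := by
  have h0 : (0 : ℝ) < p := by linarith
  rw [eLpNorm_eq_lintegral_rpow_enorm_toReal (by simpa using h0) ENNReal.ofReal_ne_top,
    ENNReal.toReal_ofReal h0.le, ← ENNReal.rpow_mul, one_div_mul_cancel h0.ne', ENNReal.rpow_one]
  refine lintegral_congr fun x => ?_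
  rw [Real.enorm_of_nonneg (hw x), ENNReal.ofReal_rpow_of_nonneg (hw x) h0.le]

theorem eLpNorm_one_of_nonneg {w : E n → ℝ} (hw : ∀ x, 0 ≤ w x) (S : Set (E n)) :
    eLpNorm w 1 (volume.restrict S) = ∫⁻ x in S, ENNReal.ofReal (w x) := by
  rw [eLpNorm_one_eq_lintegral_enorm]
  exact lintegral_congr fun x => Real.enorm_of_nonneg (hw x)

theorem cacc_of_mem_DGPlus (hp : 1 < p) {Ω : Set (E n)} {u : E n → ℝ}
    (hu : u ∈ DGPlus s p d H lam Ω) {x₀ : E n} (hx₀ : x₀ ∈ Ω) {ρ : ℝ}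
    (hρ : ρ < infDist x₀ (frontier Ω)) : Cacc s p d H lam u x₀ ρ := by
  intro r R hr hrR hR k
  have h := hu.2.2 x₀ hx₀ r R hr hrR (hR.trans_lt hρ) k
  rw [StrongCaccioppoli, gagliardoSeminorm_rpow hp, tailBar_rpow hp _ _ hr,
    eLpNorm_rpow_of_nonneg hp (fun x => posPart_nonneg _),
    eLpNorm_one_of_nonneg (fun x => posPart_nonneg _)] at h
  exact h

/-- The sublevel inequality for `u` at the level `-k` is the superlevel inequality for `-u` at the
level `k`. From here on a lower bound is an upper bound for `-u`. -/
theorem cacc_neg_of_mem_DGMinus (hp : 1 < p) {Ω : Set (E n)} {u : E n → ℝ}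
    (hu : u ∈ DGMinus s p d H lam Ω) {x₀ : E n} (hx₀ : x₀ ∈ Ω) {ρ : ℝ}
    (hρ : ρ < infDist x₀ (frontier Ω)) : Cacc s p d H lam (fun x => -u x) x₀ ρ := by
  intro r R hr hrR hR k
  have h := hu.2.2 x₀ hx₀ r R hr hrR (hR.trans_lt hρ) (-k)
  rw [StrongCaccioppoli, gagliardoSeminorm_rpow hp, tailBar_rpow hp _ _ hr,
    eLpNorm_rpow_of_nonneg hp (fun x => negPart_nonneg _),
    eLpNorm_one_of_nonneg (fun x => negPart_nonneg _)] at h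
  have e1 : ∀ x, (u x - -k)⁻ = (-u x - k)⁺ := fun x => by
    rw [← posPart_neg]; congr 1; ring
  have e2 : ∀ x, (u x - -k)⁺ = (-u x - k)⁻ := fun x => by
    rw [← posPart_neg]; congr 1; ring
  have e3 : {x | u x < -k} = {x | k < -u x} := by
    ext x; simp only [mem_ofPred_eq]; constructor <;> intro h <;> linarith
  simp only [e1, e2, e3] at h
  exact h

theorem energy_congr {w w' : E n → ℝ} (h : w =ᵐ[volume] w') (S : Set (E n)) :
    energy s p w S = energy s p w' S := by
  have h' := ae_restrict_of_ae (s := S) h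
  refine lintegral_congr_ae ?_
  filter_upwards [h'] with x hx
  refine lintegral_congr_ae ?_
  filter_upwards [h'] with y hy
  rw [hx, hy]

theorem tailInt_congr {w w' : E n → ℝ} (h : w =ᵐ[volume] w') (x₀ : E n) (r : ℝ) :
    tailInt s p w x₀ r = tailInt s p w' x₀ r := by
  refine lintegral_congr_ae ?_
  filter_upwards [ae_restrict_of_ae h] with x hx
  rw [hx]

theorem interaction_congr {w w' v v' : E n → ℝ} (hw : w =ᵐ[volume] w') (hv : v =ᵐ[volume] v')
    (S : Set (E n)) : interaction s p w v S = interaction s p w' v' S := by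
  refine lintegral_congr_ae ?_
  filter_upwards [ae_restrict_of_ae hw] with x hx
  rw [hx]
  congr 1
  refine lintegral_congr_ae ?_
  filter_upwards [hv] with y hy
  rw [hy]

/-- Allows the Lebesgue measurable `u` to be replaced by a Borel representative. -/
theorem Cacc.congr {f g : E n → ℝ} {x₀ : E n} {ρ : ℝ} (hf : Cacc s p d H lam f x₀ ρ)
    (h : f =ᵐ[volume] g) : Cacc s p d H lam g x₀ ρ := by
  intro r R hr hrR hR k
  have h1 : (fun x => (f x - k)⁺) =ᵐ[volume] fun x => (g x - k)⁺ := by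
    filter_upwards [h] with x hx; rw [hx]
  have h2 : (fun x => (f x - k)⁻) =ᵐ[volume] fun x => (g x - k)⁻ := by
    filter_upwards [h] with x hx; rw [hx]
  have h3 : volume ({x | k < f x} ∩ ball x₀ R) = volume ({x | k < g x} ∩ ball x₀ R) := by
    refine measure_congr ?_
    filter_upwards [h] with x hx
    refine propext ?_
    change (k < f x ∧ _) ↔ (k < g x ∧ _)
    rw [hx]
  have h4 : ∫⁻ x in ball x₀ R, ENNReal.ofReal ((f x - k)⁺ ^ p)
      = ∫⁻ x in ball x₀ R, ENNReal.ofReal ((g x - k)⁺ ^ p) := by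
    refine lintegral_congr_ae (ae_restrict_of_ae ?_)
    filter_upwards [h] with x hx; rw [hx]
  have h5 : ∫⁻ x in ball x₀ R, ENNReal.ofReal ((f x - k)⁺)
      = ∫⁻ x in ball x₀ R, ENNReal.ofReal ((g x - k)⁺) := by
    refine lintegral_congr_ae (ae_restrict_of_ae ?_)
    filter_upwards [h] with x hx; rw [hx]
  have := hf r R hr hrR hR k
  rwa [energy_congr h1, interaction_congr h1 h2, h3, h4, h5, tailInt_congr h1] at this

theorem Cacc.mono {f : E n → ℝ} {x₀ : E n} {ρ ρ' : ℝ} (hf : Cacc s p d H lam f x₀ ρ)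
    (h : ρ' ≤ ρ) : Cacc s p d H lam f x₀ ρ' :=
  fun r R hr hrR hR k => hf r R hr hrR (hR.trans h) k

/-! ### Volumes of balls and a fractional Faber-Krahn inequality -/

/-- The volume of the unit ball. -/
def unitVol (n : ℕ) : ℝ := (volume (ball (0 : E n) 1)).toReal

theorem unitVol_pos (n : ℕ) : 0 < unitVol n :=
  ENNReal.toReal_pos (measure_ball_pos _ _ one_pos).ne' measure_ball_lt_top.ne

theorem volume_ball_eq (hn : 1 ≤ n) (x : E n) {r : ℝ} (hr : 0 ≤ r) :
    volume (ball x r) = ENNReal.ofReal (unitVol n * r ^ n) := by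
  have : Nonempty (Fin n) := ⟨⟨0, hn⟩⟩
  rw [Measure.addHaar_ball _ _ hr, finrank_euclideanSpace_fin, unitVol, mul_comm,
    ENNReal.ofReal_mul ENNReal.toReal_nonneg, ENNReal.ofReal_toReal measure_ball_lt_top.ne]

/-- A ball of radius at most the diameter of another, centred in it, meets it in a large set. -/
theorem volume_ball_inter_ge (hn : 1 ≤ n) {x x₀ : E n} {r ρ : ℝ} (hx : x ∈ ball x₀ r)
    (hρ : 0 < ρ) (hρr : ρ ≤ 2 * r) :
    ENNReal.ofReal (unitVol n * (ρ / 2) ^ n) ≤ volume (ball x ρ ∩ ball x₀ r) := by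
  have hr : 0 < r := by linarith
  set θ : ℝ := ρ / (2 * r) with hθ
  have hθ0 : 0 < θ := by positivity
  have hθ1 : θ ≤ 1 := by rw [hθ, div_le_one (by positivity)]; exact hρr
  -- Moving from `x` towards `x₀` by the fraction `θ` gives a centre whose ball of radius `ρ / 2`
  -- fits inside both balls.
  set z : E n := x + θ • (x₀ - x) with hz
  have hd : ‖x - x₀‖ < r := by rwa [mem_ball, dist_eq_norm] at hx
  rw [← volume_ball_eq hn z (by positivity)]
  have hθr : θ * r = ρ / 2 := by rw [hθ]; field_simp
  refine measure_mono (subset_inter (ball_subset_ball' ?_) (ball_subset_ball' ?_))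
  · have : dist z x = θ * ‖x - x₀‖ := by
      rw [dist_eq_norm, hz, add_sub_cancel_left, norm_smul, Real.norm_of_nonneg hθ0.le,
        norm_sub_rev]
    nlinarith
  · have : dist z x₀ = (1 - θ) * ‖x - x₀‖ := by
      rw [dist_eq_norm, hz, show x + θ • (x₀ - x) - x₀ = (1 - θ) • (x - x₀) by module,
        norm_smul, Real.norm_of_nonneg (by linarith)]
    nlinarith

/-- A fractional Faber-Krahn inequality: the `L^p` norm of a function on a ball is controlled by
its Gagliardo energy, with a factor measuring the size of the support. -/
theorem lintegral_rpow_le_energy (hn : 1 ≤ n) (hs : 0 < s) (hp : 1 < p) {w : E n → ℝ}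
    (hwm : Measurable w) (hw : ∀ x, 0 ≤ w x) {x₀ : E n} {r ρ : ℝ} (hρ : 0 < ρ) (hρr : ρ ≤ 2 * r)
    (hA : volume ({x | 0 < w x} ∩ ball x₀ r) ≤ ENNReal.ofReal (unitVol n * (ρ / 2) ^ n / 2)) :
    ∫⁻ x in ball x₀ r, ENNReal.ofReal (w x ^ p)
      ≤ ENNReal.ofReal (2 ^ (n + 1) / unitVol n * ρ ^ (s * p)) * energy s p w (ball x₀ r) := by
  have hV := unitVol_pos n
  have hp0 : 0 < p := by linarith
  set c : ℝ := unitVol n * (ρ / 2) ^ n / 2 with hc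
  have hc0 : 0 < c := by positivity
  set e : ℝ := (n : ℝ) + s * p with he
  have hAm : MeasurableSet {x | 0 < w x} := measurableSet_lt measurable_const hwm
  have key : ∀ x ∈ ball x₀ r, ENNReal.ofReal (c / ρ ^ e) * ENNReal.ofReal (w x ^ p)
      ≤ ∫⁻ y in ball x₀ r, ENNReal.ofReal (|w x - w y| ^ p / ‖x - y‖ ^ e) := by
    intro x hx
    -- On `T` the function `w` vanishes, so `|w x - w y| = w x` there. The support fills at most
    -- half of the guaranteed volume, which leaves measure at least `c` for `T`.
    set T : Set (E n) := (ball x ρ ∩ ball x₀ r) \ ({x | 0 < w x} ∩ ball x₀ r) with hT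
    have hTm : MeasurableSet T :=
      (measurableSet_ball.inter measurableSet_ball).diff (hAm.inter measurableSet_ball)
    have hTv : ENNReal.ofReal c ≤ volume T := by
      have h1 := volume_ball_inter_ge hn hx hρ hρr
      have h2 : volume (ball x ρ ∩ ball x₀ r) - volume ({x | 0 < w x} ∩ ball x₀ r) ≤ volume T :=
        le_measure_sdiff
      refine le_trans ?_ h2
      refine le_trans ?_ (tsub_le_tsub h1 hA)
      rw [← ENNReal.ofReal_sub _ hc0.le]
      apply ENNReal.ofReal_le_ofReal
      rw [hc]; linarith
    calc ENNReal.ofReal (c / ρ ^ e) * ENNReal.ofReal (w x ^ p)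
        = ENNReal.ofReal (w x ^ p / ρ ^ e) * ENNReal.ofReal c := by
          rw [← ENNReal.ofReal_mul (by positivity),
            ← ENNReal.ofReal_mul (by have := hw x; positivity)]
          congr 1; ring
      _ ≤ ENNReal.ofReal (w x ^ p / ρ ^ e) * volume T := by gcongr
      _ = ∫⁻ y in T, ENNReal.ofReal (w x ^ p / ρ ^ e) := by rw [setLIntegral_const]
      _ ≤ ∫⁻ y in T, ENNReal.ofReal (|w x - w y| ^ p / ‖x - y‖ ^ e) := by
          refine setLIntegral_mono_ae' hTm (.of_forall fun y hy => ?_)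
          have hy0 : w y = 0 := by
            refine le_antisymm (not_lt.1 fun h => hy.2 ⟨h, hy.1.2⟩) (hw y)
          rw [hy0, sub_zero, abs_of_nonneg (hw x)]
          have hxy : ‖x - y‖ ≤ ρ := by
            have := hy.1.1; rw [mem_ball, dist_eq_norm, norm_sub_rev] at this; exact this.le
          rcases (hw x).eq_or_lt with h0 | h0
          · rw [← h0, Real.zero_rpow hp0.ne']; simp
          have hne : x ≠ y := by rintro rfl; exact h0.ne' hy0
          have : 0 < ‖x - y‖ := norm_pos_iff.2 (sub_ne_zero.2 hne)
          gcongr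
      _ ≤ _ := lintegral_mono_set (sdiff_subset.trans inter_subset_right)
  have h2 : ENNReal.ofReal (c / ρ ^ e) * ∫⁻ x in ball x₀ r, ENNReal.ofReal (w x ^ p)
      ≤ energy s p w (ball x₀ r) := by
    rw [← lintegral_const_mul _ (by fun_prop)]
    exact setLIntegral_mono_ae' measurableSet_ball (.of_forall key)
  calc ∫⁻ x in ball x₀ r, ENNReal.ofReal (w x ^ p)
      = ENNReal.ofReal (2 ^ (n + 1) / unitVol n * ρ ^ (s * p)) *
        (ENNReal.ofReal (c / ρ ^ e) * ∫⁻ x in ball x₀ r, ENNReal.ofReal (w x ^ p)) := by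
        rw [← mul_assoc, ← ENNReal.ofReal_mul (by positivity)]
        have : 2 ^ (n + 1) / unitVol n * ρ ^ (s * p) * (c / ρ ^ e) = 1 := by
          rw [hc, he, Real.rpow_add hρ, Real.rpow_natCast, div_pow]
          field_simp
          ring
        rw [this]; simp
    _ ≤ _ := by gcongr

/-! ### The De Giorgi iteration -/

theorem tailInt_mono (hp : 1 < p) {w w' : E n → ℝ} (h : ∀ x, |w x| ≤ |w' x|) (x₀ : E n)
    {r r' : ℝ} (hr : r' ≤ r) : tailInt s p w x₀ r ≤ tailInt s p w' x₀ r' := by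
  refine (lintegral_mono_set (compl_subset_compl.2 (ball_subset_ball hr))).trans ?_
  refine lintegral_mono fun x => ENNReal.ofReal_le_ofReal ?_
  have h1 := Real.rpow_le_rpow (abs_nonneg _) (h x) (by linarith : (0 : ℝ) ≤ p - 1)
  gcongr

/-- Chebyshev's inequality across two levels. -/
theorem volume_superlevel_le (hp : 1 < p) {f : E n → ℝ} (hf : Measurable f) {l l' h : ℝ}
    (hh : 0 < h) (hl : l + h ≤ l') (S : Set (E n)) (hS : MeasurableSet S) :
    volume ({x | l' < f x} ∩ S)
      ≤ ENNReal.ofReal ((1 / h) ^ p) * ∫⁻ x in S, ENNReal.ofReal ((f x - l)⁺ ^ p) := by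
  have hA : MeasurableSet {x | l' < f x} := measurableSet_lt measurable_const hf
  rw [← lintegral_const_mul _ (by fun_prop), ← setLIntegral_one]
  refine (setLIntegral_mono_ae' (hA.inter hS) (.of_forall fun x hx => ?_)).trans
    (lintegral_mono_set inter_subset_right)
  rw [← ENNReal.ofReal_mul (by positivity), ← Real.mul_rpow (by positivity) (posPart_nonneg _)]
  have h1 : h ≤ (f x - l)⁺ := by
    have : l' < f x := hx.1
    exact le_trans (by linarith) (le_posPart _)
  rw [← ENNReal.ofReal_one]
  refine ENNReal.ofReal_le_ofReal (Real.one_le_rpow ?_ (by linarith))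
  rw [one_div_mul_eq_div, one_le_div hh]
  exact h1

/-- Where the left side is positive, `a - l ≥ h`, so the factor `((a - l) / h)^{p-1}` is at least
`1`. This bounds an `L^1` excess by the `L^p` excess at a lower level. -/
theorem posPart_le_rpow (hp : 1 < p) {a l l' h : ℝ} (hh : 0 < h) (hl : l + h ≤ l') :
    (a - l')⁺ ≤ (1 / h) ^ (p - 1) * (a - l)⁺ ^ p := by
  rcases le_total a l' with h0 | h0
  · rw [posPart_eq_zero.2 (by linarith)]
    have := posPart_nonneg (a - l)
    positivity
  have h1 : h ≤ a - l := by linarith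
  have h2 : 0 < a - l := by linarith
  rw [posPart_eq_self.2 (by linarith : 0 ≤ a - l'), posPart_eq_self.2 h2.le,
    show (a - l) ^ p = (a - l) ^ (p - 1) * (a - l) by
      rw [← Real.rpow_add_one h2.ne']; congr 1; ring,
    ← mul_assoc, ← Real.mul_rpow (by positivity) h2.le]
  have : 1 ≤ (1 / h * (a - l)) ^ (p - 1) := by
    refine Real.one_le_rpow ?_ (by linarith)
    rw [one_div_mul_eq_div, one_le_div hh]
    exact h1
  nlinarith

/-- One step of the De Giorgi iteration: the energy at a higher level on a smaller ball. -/
theorem Cacc.energy_le (hs : 0 < s) (hs1 : s < 1) (hp : 1 < p) (hH : 0 ≤ H) (hlam : 0 ≤ lam)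
    (hd : 0 ≤ d) {f : E n → ℝ} (hfm : Measurable f) {x₀ : E n} {R : ℝ} (hR : 0 < R)
    (hf : Cacc s p d H lam f x₀ R) {Λ K Q r r' l l' : ℝ} (hΛ : 0 ≤ Λ) (hK : 0 < K) (hQ : 1 ≤ Q)
    (hr : R / 2 ≤ r) (hrr : r' - r = R / Q) (hr' : r' ≤ R) (hl : l + K / Q ≤ l')
    (hdK : R ^ (lam + s * p) * d ^ p ≤ Λ * K ^ p)
    (htail : tailInt s p (fun x => (f x - l)⁺) x₀ (R / 2)
      ≤ ENNReal.ofReal (Λ * K ^ (p - 1) * R ^ (-(s * p)))) :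
    energy s p (fun x => (f x - l')⁺) (ball x₀ r)
      ≤ ENNReal.ofReal (H * (2 * Λ + 1) * Q ^ ((n : ℝ) + s * p + p) * R ^ (-(s * p)))
        * ∫⁻ x in ball x₀ r', ENNReal.ofReal ((f x - l)⁺ ^ p) := by
  have hQ0 : 0 < Q := by linarith
  have hRQ : 0 < R / Q := by positivity
  have hr0 : 0 < r := by linarith
  have hr'0 : 0 < r' := by linarith
  have hKQ : 0 < K / Q := by positivity
  have hll : l ≤ l' := by linarith
  set Y := ∫⁻ x in ball x₀ r', ENNReal.ofReal ((f x - l)⁺ ^ p) with hY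
  have hpos : ∀ x, (f x - l')⁺ ≤ (f x - l)⁺ := fun x => posPart_mono (by linarith)
  have hC := hf r r' hr0 (by linarith) hr' l'
  -- The interaction term is dropped; only the energy matters for the iteration.
  refine (le_self_add.trans hC).trans ?_
  have hinv : 1 / (K / Q) = Q / K := by field_simp
  have t1 : ENNReal.ofReal (r' ^ lam * d ^ p) * volume ({x | l' < f x} ∩ ball x₀ r')
      ≤ ENNReal.ofReal (Λ * Q ^ p * R ^ (-(s * p))) * Y := by
    calc _ ≤ ENNReal.ofReal (Λ * K ^ p * R ^ (-(s * p))) * (ENNReal.ofReal ((Q / K) ^ p) * Y) := by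
          gcongr ENNReal.ofReal ?_ * ?_
          · calc r' ^ lam * d ^ p ≤ R ^ lam * d ^ p := by gcongr
              _ = R ^ (lam + s * p) * d ^ p * R ^ (-(s * p)) := by
                  rw [mul_right_comm, ← Real.rpow_add hR]; congr 2; ring
              _ ≤ _ := by gcongr
          · rw [← hinv]
            exact volume_superlevel_le hp hfm hKQ hl _ measurableSet_ball
      _ = _ := by
          rw [← mul_assoc, ← ENNReal.ofReal_mul (by positivity), Real.div_rpow hQ0.le hK.le]
          congr 2
          field_simp
  have t2 : ENNReal.ofReal (r' ^ ((1 - s) * p) / (r' - r) ^ p)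
      * (∫⁻ x in ball x₀ r', ENNReal.ofReal ((f x - l')⁺ ^ p))
      ≤ ENNReal.ofReal (Q ^ p * R ^ (-(s * p))) * Y := by
    gcongr ENNReal.ofReal ?_ * ?_
    · calc r' ^ ((1 - s) * p) / (r' - r) ^ p ≤ R ^ ((1 - s) * p) / (R / Q) ^ p := by
            rw [hrr]
            have : 0 ≤ (1 - s) * p := by nlinarith
            gcongr
        _ = _ := by
            rw [Real.div_rpow hR.le hQ0.le, show (1 - s) * p = p + -(s * p) by ring,
              Real.rpow_add hR]
            field_simp
    · refine lintegral_mono fun x => ENNReal.ofReal_le_ofReal ?_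
      exact Real.rpow_le_rpow (posPart_nonneg _) (hpos x) (by linarith)
  have t3 : ENNReal.ofReal (r' ^ ((n : ℝ) + s * p) / (r' - r) ^ ((n : ℝ) + s * p))
      * (∫⁻ x in ball x₀ r', ENNReal.ofReal ((f x - l')⁺))
      * tailInt s p (fun x => (f x - l')⁺) x₀ r
      ≤ ENNReal.ofReal (Λ * (Q ^ ((n : ℝ) + s * p) * Q ^ (p - 1)) * R ^ (-(s * p))) * Y := by
    have he : 0 ≤ (n : ℝ) + s * p := by positivity
    calc _ ≤ ENNReal.ofReal (Q ^ ((n : ℝ) + s * p))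
          * (ENNReal.ofReal ((Q / K) ^ (p - 1)) * Y)
          * ENNReal.ofReal (Λ * K ^ (p - 1) * R ^ (-(s * p))) := by
          gcongr ENNReal.ofReal ?_ * ?_ * ?_
          · rw [hrr, ← Real.div_rpow hr'0.le hRQ.le]
            refine Real.rpow_le_rpow (by positivity) ?_ he
            rw [div_le_iff₀ hRQ]
            calc r' ≤ R := hr'
              _ = Q * (R / Q) := by field_simp
          · rw [hY, ← lintegral_const_mul _ (by fun_prop), ← hinv]
            refine lintegral_mono fun x => ?_
            rw [← ENNReal.ofReal_mul (by positivity)]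
            exact ENNReal.ofReal_le_ofReal (posPart_le_rpow hp hKQ hl)
          · refine (tailInt_mono hp (fun x => ?_) x₀ hr).trans htail
            rw [abs_of_nonneg (posPart_nonneg _), abs_of_nonneg (posPart_nonneg _)]
            exact hpos x
      _ = _ := by
          rw [← mul_assoc, mul_right_comm, ← ENNReal.ofReal_mul (by positivity),
            ← ENNReal.ofReal_mul (by positivity), Real.div_rpow hQ0.le hK.le]
          congr 2
          field_simp
  calc _ ≤ ENNReal.ofReal H * (ENNReal.ofReal (Λ * Q ^ p * R ^ (-(s * p))) * Y
        + ENNReal.ofReal (Q ^ p * R ^ (-(s * p))) * Y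
        + ENNReal.ofReal (Λ * (Q ^ ((n : ℝ) + s * p) * Q ^ (p - 1)) * R ^ (-(s * p))) * Y) := by
        gcongr
    _ = ENNReal.ofReal (H * (Λ * Q ^ p * R ^ (-(s * p)) + Q ^ p * R ^ (-(s * p))
          + Λ * (Q ^ ((n : ℝ) + s * p) * Q ^ (p - 1)) * R ^ (-(s * p)))) * Y := by
        rw [← add_mul, ← add_mul, ← mul_assoc, ← ENNReal.ofReal_add (by positivity) (by positivity),
          ← ENNReal.ofReal_add (by positivity) (by positivity), ← ENNReal.ofReal_mul hH]
    _ ≤ _ := by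
        -- The powers of `Q` in the three terms are `p`, `p` and `n + sp + p - 1`; all are at most
        -- `n + sp + p`.
        gcongr ENNReal.ofReal ?_ * Y
        have a1 : Q ^ p ≤ Q ^ ((n : ℝ) + s * p + p) := by
          refine Real.rpow_le_rpow_of_exponent_le hQ ?_
          have : 0 ≤ (n : ℝ) + s * p := by positivity
          linarith
        have a2 : Q ^ ((n : ℝ) + s * p) * Q ^ (p - 1) ≤ Q ^ ((n : ℝ) + s * p + p) := by
          rw [← Real.rpow_add hQ0]
          exact Real.rpow_le_rpow_of_exponent_le hQ (by linarith)
        calc _ = H * (Λ * Q ^ p + Q ^ p + Λ * (Q ^ ((n : ℝ) + s * p) * Q ^ (p - 1)))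
              * R ^ (-(s * p)) := by ring
          _ ≤ H * (Λ * Q ^ ((n : ℝ) + s * p + p) + Q ^ ((n : ℝ) + s * p + p)
              + Λ * Q ^ ((n : ℝ) + s * p + p)) * R ^ (-(s * p)) := by gcongr
          _ = _ := by ring

theorem ae_le_of_lintegral_posPart_eq_zero {f : E n → ℝ} (hf : Measurable f) {l : ℝ}
    {S : Set (E n)} (h : (∫⁻ x in S, ENNReal.ofReal ((f x - l)⁺ ^ p)) = 0) :
    ∀ᵐ x ∂volume.restrict S, f x ≤ l := by
  rw [lintegral_eq_zero_iff (by fun_prop)] at h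
  filter_upwards [h] with x hx
  by_contra! hlt
  have : 0 < (f x - l)⁺ := posPart_pos_iff.2 (by linarith)
  exact (ENNReal.ofReal_pos.2 (Real.rpow_pos_of_pos this p)).ne' hx

set_option maxHeartbeats 800000 in
/-- The De Giorgi iteration: a function which exceeds the level `k` on a ball only slightly in the
`L^p` sense does not exceed `k + K` on the half ball. -/
theorem exists_iteration_threshold (hn : 1 ≤ n) (hs : 0 < s) (hs1 : s < 1) (hp : 1 < p)
    (hH : 1 ≤ H) (hlam : 0 ≤ lam) {Λ : ℝ} (hΛ : 0 ≤ Λ) :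
    ∃ θ : ℝ, 0 < θ ∧ ∀ (d : ℝ), 0 ≤ d → ∀ (f : E n → ℝ), Measurable f → ∀ (x₀ : E n) (R : ℝ),
      0 < R → Cacc s p d H lam f x₀ R → ∀ k K : ℝ, 0 < K →
      R ^ (lam + s * p) * d ^ p ≤ Λ * K ^ p →
      tailInt s p (fun x => (f x - k)⁺) x₀ (R / 2)
        ≤ ENNReal.ofReal (Λ * K ^ (p - 1) * R ^ (-(s * p))) →
      (∫⁻ x in ball x₀ R, ENNReal.ofReal ((f x - k)⁺ ^ p)) ≤ ENNReal.ofReal (θ * K ^ p * R ^ n) →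
      ∀ᵐ x ∂volume.restrict (ball x₀ (R / 2)), f x ≤ k + K := by
  have hV := unitVol_pos n
  have hsp : 0 < s * p := by positivity
  set N : ℝ := (n : ℝ) + s * p + p with hN
  set D : ℝ := 2 ^ (n + 1) / unitVol n * (H * (2 * Λ + 1)) * 4 ^ N with hD
  have hD0 : 0 < D := by positivity
  -- The Faber-Krahn scale at step `j` will be `R σ μ^j`. Its gain `μ^{sp}` per step exactly
  -- compensates the Caccioppoli loss `2^N` per step.
  set μ : ℝ := 2 ^ (-(N / (s * p))) with hμ
  have hμ0 : 0 < μ := by positivity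
  have hμ1 : μ ≤ 1 := by
    refine Real.rpow_le_one_of_one_le_of_nonpos (by norm_num) ?_
    have : 0 ≤ N / (s * p) := by positivity
    linarith
  have hμN : μ ^ (s * p) * 2 ^ N = 1 := by
    rw [hμ, ← Real.rpow_mul (by norm_num), ← Real.rpow_add (by norm_num),
      show -(N / (s * p)) * (s * p) + N = 0 by field_simp; ring, Real.rpow_zero]
  -- Chebyshev's inequality loses `2^p` per step, and superlevel sets must shrink like `μ^n` per
  -- step to be small at the scale `R σ μ^j`; this dictates the decay rate `q` of the excess.
  set q : ℝ := μ ^ n / 2 ^ p with hq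
  have hq0 : 0 < q := by positivity
  have hq1 : q < 1 := by
    have h1 : μ ^ n ≤ 1 := pow_le_one₀ hμ0.le hμ1
    have h2 : (1 : ℝ) < 2 ^ p := Real.one_lt_rpow (by norm_num) (by linarith)
    rw [hq, div_lt_one (by positivity)]
    linarith
  -- `σ` absorbs the constant `D` of one step, and `σ ≤ 1` keeps the scale below the diameter of the
  -- ball.
  set σ : ℝ := min 1 ((q / D) ^ (1 / (s * p))) with hσ
  have hσ0 : 0 < σ := lt_min one_pos (by positivity)
  have hσ1 : σ ≤ 1 := min_le_left _ _
  have hσD : D * σ ^ (s * p) ≤ q := by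
    have : σ ^ (s * p) ≤ q / D := by
      calc σ ^ (s * p) ≤ ((q / D) ^ (1 / (s * p))) ^ (s * p) := by
            gcongr; exact min_le_right _ _
        _ = q / D := by
            rw [← Real.rpow_mul (by positivity), one_div_mul_cancel hsp.ne', Real.rpow_one]
    rwa [le_div_iff₀ hD0, mul_comm] at this
  refine ⟨unitVol n * σ ^ n / (2 ^ (n + 1) * 4 ^ p), by positivity, ?_⟩
  -- With this `θ` the Chebyshev bound equals the volume allowed by Faber-Krahn at every step; see
  -- `hvol`.
  set θ : ℝ := unitVol n * σ ^ n / (2 ^ (n + 1) * 4 ^ p) with hθ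
  have hθ0 : 0 < θ := by positivity
  intro d hd f hfm x₀ R hR hf k K hK hdK htail hY0
  set rr : ℕ → ℝ := fun j => R * (1 + (1 / 2) ^ j) / 2 with hrr
  set kk : ℕ → ℝ := fun j => k + K * (1 - (1 / 2) ^ j) with hkk
  have hhalf0 : ∀ j : ℕ, (0 : ℝ) < (1 / 2) ^ j := fun j => by positivity
  have hhalf1 : ∀ j : ℕ, ((1 : ℝ) / 2) ^ j ≤ 1 := fun j =>
    pow_le_one₀ (by norm_num) (by norm_num)
  have hrrR : ∀ j, R / 2 ≤ rr j := fun j => by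
    have := hhalf0 j
    simp only [hrr]; nlinarith
  have hrrR' : ∀ j, rr j ≤ R := fun j => by
    have := hhalf1 j
    simp only [hrr]; nlinarith
  have hkk0 : ∀ j, k ≤ kk j := fun j => by
    have := hhalf1 j
    simp only [hkk]; nlinarith
  have hkk1 : ∀ j, kk j ≤ k + K := fun j => by
    have := hhalf0 j
    simp only [hkk]; nlinarith
  have main : ∀ j, (∫⁻ x in ball x₀ (rr j), ENNReal.ofReal ((f x - kk j)⁺ ^ p))
      ≤ ENNReal.ofReal (θ * K ^ p * R ^ n * q ^ j) := by
    intro j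
    induction j with
    | zero =>
      have e : R * (1 + 1) / 2 = R := by ring
      simpa [hrr, hkk, e] using hY0
    | succ j ih =>
      -- Consecutive radii differ by `R / Q`, consecutive levels by `2K / Q`.
      set Q : ℝ := 2 ^ (j + 2) with hQ
      have hQ1 : 1 ≤ Q := one_le_pow₀ (by norm_num)
      have hQ0 : 0 < Q := by positivity
      have hQj : (1 / 2 : ℝ) ^ j = 4 / Q := by
        rw [hQ, pow_add, one_div_pow]; field_simp; norm_num
      have hQp : ∀ a : ℝ, Q ^ a = 4 ^ a * (2 ^ a) ^ j := fun a => by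
        rw [hQ, pow_add, mul_comm, Real.mul_rpow (by norm_num) (by positivity),
          ← Real.rpow_natCast (2 ^ a), ← Real.rpow_mul (by norm_num), mul_comm a,
          Real.rpow_mul (by norm_num), Real.rpow_natCast]
        norm_num
      have hrj : rr j - rr (j + 1) = R / Q := by
        simp only [hrr, pow_succ, hQj]; field_simp; ring
      have hkj : kk j + K / Q ≤ kk (j + 1) := by
        simp only [hkk, pow_succ, hQj]
        have : 0 < K / Q := by positivity
        have e : K * (1 - 4 / Q * (1 / 2)) = K * (1 - 4 / Q) + 2 * (K / Q) := by field_simp; ring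
        rw [e]; linarith
      have hen := hf.energy_le hs hs1 hp (by linarith) hlam hd hfm hR hΛ hK hQ1 (hrrR (j + 1))
        hrj (hrrR' j) hkj hdK ((tailInt_mono hp (fun x => by
          rw [abs_of_nonneg (posPart_nonneg _), abs_of_nonneg (posPart_nonneg _)]
          exact posPart_mono (by linarith [hkk0 j])) x₀ le_rfl).trans htail)
      have hsub : ball x₀ (rr (j + 1)) ⊆ ball x₀ (rr j) := ball_subset_ball (by
        have : 0 < R / Q := by positivity
        linarith)
      have hvol : volume ({x | 0 < (f x - kk (j + 1))⁺} ∩ ball x₀ (rr (j + 1)))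
          ≤ ENNReal.ofReal (unitVol n * (R * σ * μ ^ j / 2) ^ n / 2) := by
        have e : {x | 0 < (f x - kk (j + 1))⁺} = {x | kk (j + 1) < f x} := by
          ext x; simp only [mem_ofPred_eq, posPart_pos_iff, sub_pos]
        rw [e]
        refine (measure_mono (inter_subset_inter_right _ hsub)).trans ?_
        refine (volume_superlevel_le hp hfm (by positivity : 0 < K / Q) hkj _
          measurableSet_ball).trans ?_
        refine (mul_le_mul_right ih _).trans ?_
        rw [← ENNReal.ofReal_mul (by positivity)]
        refine ENNReal.ofReal_le_ofReal (le_of_eq ?_)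
        rw [one_div_div, Real.div_rpow hQ0.le hK.le, hQp, hθ, hq, div_pow, div_pow]
        field_simp
        ring
      refine (lintegral_rpow_le_energy hn hs hp (by fun_prop) (fun x => posPart_nonneg _)
        (by positivity) ?_ hvol).trans ?_
      · have h1 : σ * μ ^ j ≤ 1 := mul_le_one₀ hσ1 (by positivity) (pow_le_one₀ hμ0.le hμ1)
        have := hrrR (j + 1)
        nlinarith
      refine (mul_le_mul_right (hen.trans (mul_le_mul_right ih _)) _).trans ?_
      rw [← mul_assoc, ← ENNReal.ofReal_mul (by positivity), ← ENNReal.ofReal_mul (by positivity)]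
      refine ENNReal.ofReal_le_ofReal ?_
      have e1 : (R * σ * μ ^ j) ^ (s * p) = R ^ (s * p) * σ ^ (s * p) * (μ ^ (s * p)) ^ j := by
        rw [Real.mul_rpow (by positivity) (by positivity), Real.mul_rpow hR.le hσ0.le]
        congr 1
        rw [← Real.rpow_natCast, ← Real.rpow_natCast, ← Real.rpow_mul hμ0.le,
          ← Real.rpow_mul hμ0.le, mul_comm]
      have e2 : (μ ^ (s * p)) ^ j * (2 ^ N) ^ j = 1 := by rw [← mul_pow, hμN, one_pow]
      have e3 : R ^ (s * p) * R ^ (-(s * p)) = 1 := by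
        rw [← Real.rpow_add hR, add_neg_cancel, Real.rpow_zero]
      rw [e1, hQp]
      calc _ = D * σ ^ (s * p) * ((μ ^ (s * p)) ^ j * (2 ^ N) ^ j)
            * (R ^ (s * p) * R ^ (-(s * p))) * (θ * K ^ p * R ^ n * q ^ j) := by
            rw [hD]; ring
        _ ≤ q * (θ * K ^ p * R ^ n * q ^ j) := by
            rw [e2, e3, mul_one, mul_one]; gcongr
        _ = _ := by ring
  -- The half ball and the level `k + K` are the limits of `rr` and `kk`; the excess there is below
  -- `θ K^p R^n q^j` for every `j`, hence zero.
  refine ae_le_of_lintegral_posPart_eq_zero (p := p) hfm (le_antisymm ?_ zero_le)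
  have hlim : Filter.Tendsto (fun j : ℕ => ENNReal.ofReal (θ * K ^ p * R ^ n * q ^ j))
      Filter.atTop (nhds 0) := by
    rw [← ENNReal.ofReal_zero]
    refine ENNReal.tendsto_ofReal ?_
    rw [← mul_zero (θ * K ^ p * R ^ n)]
    exact (tendsto_pow_atTop_nhds_zero_of_lt_one hq0.le hq1).const_mul _
  refine ge_of_tendsto' hlim fun j => le_trans ?_ (main j)
  refine (lintegral_mono_set (ball_subset_ball (hrrR j))).trans ?_
  refine lintegral_mono fun x => ENNReal.ofReal_le_ofReal ?_
  refine Real.rpow_le_rpow (posPart_nonneg _) (posPart_mono ?_) (by linarith)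
  linarith [hkk1 j]

/-! ### Kernel integrals and tails -/

theorem lintegral_compl_ball_scale (x₀ : E n) {r : ℝ} (hr : 0 < r) {G : E n → ℝ≥0∞}
    (hG : Measurable G) :
    ∫⁻ x in (ball x₀ r)ᶜ, G (r⁻¹ • (x - x₀))
      = ENNReal.ofReal (r ^ n) * ∫⁻ y in (ball (0 : E n) 1)ᶜ, G y := by
  have hm : MeasurableSet (ball (0 : E n) 1)ᶜ := measurableSet_ball.compl
  rw [← lintegral_indicator measurableSet_ball.compl, ← lintegral_indicator hm]
  set F : E n → ℝ≥0∞ := (ball (0 : E n) 1)ᶜ.indicator G with hF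
  have hFm : Measurable F := hG.indicator hm
  have h1 : ∀ x, (ball x₀ r)ᶜ.indicator (fun x => G (r⁻¹ • (x - x₀))) (x + x₀)
      = F (r⁻¹ • x) := by
    intro x
    have : x + x₀ ∈ (ball x₀ r)ᶜ ↔ r⁻¹ • x ∈ (ball (0 : E n) 1)ᶜ := by
      simp only [mem_compl_iff, mem_ball, dist_eq_norm, add_sub_cancel_right, sub_zero, norm_smul,
        norm_inv, Real.norm_of_nonneg hr.le]
      rw [inv_mul_lt_iff₀ hr, mul_one]
    by_cases hx : x + x₀ ∈ (ball x₀ r)ᶜ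
    · rw [indicator_of_mem hx, hF, indicator_of_mem (this.1 hx), add_sub_cancel_right]
    · rw [indicator_of_notMem hx, hF, indicator_of_notMem (fun h => hx (this.2 h))]
  rw [← lintegral_add_right_eq_self _ x₀]
  simp only [h1]
  rw [← lintegral_map (f := F) (g := fun x => r⁻¹ • x) hFm (by fun_prop),
    Measure.map_addHaar_smul _ (inv_ne_zero hr.ne'), lintegral_smul_measure,
    finrank_euclideanSpace_fin, inv_pow, inv_inv, abs_of_pos (by positivity), smul_eq_mul]

/-- Scaling of integrals against the kernel `|x - x₀|^{-n-sp}`. -/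
theorem lintegral_kernel_scale (x₀ : E n) {r : ℝ} (hr : 0 < r) {g : ℝ → ℝ} (hg : Measurable g) :
    ∫⁻ x in (ball x₀ r)ᶜ, ENNReal.ofReal (g (‖x - x₀‖ / r) / ‖x - x₀‖ ^ ((n : ℝ) + s * p))
      = ENNReal.ofReal (r ^ (-(s * p))) *
        ∫⁻ y in (ball (0 : E n) 1)ᶜ, ENNReal.ofReal (g ‖y‖ / ‖y‖ ^ ((n : ℝ) + s * p)) := by
  have h := lintegral_compl_ball_scale x₀ hr
    (G := fun y : E n => ENNReal.ofReal (g ‖y‖ / ‖y‖ ^ ((n : ℝ) + s * p)))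
    (((hg.comp measurable_norm).div (by fun_prop)).ennreal_ofReal)
  have hn : ∀ x : E n, ‖r⁻¹ • (x - x₀)‖ = ‖x - x₀‖ / r := fun x => by
    rw [norm_smul, norm_inv, Real.norm_of_nonneg hr.le, inv_mul_eq_div]
  have e : ∀ x : E n, ENNReal.ofReal (g (‖x - x₀‖ / r) / ‖x - x₀‖ ^ ((n : ℝ) + s * p))
      = ENNReal.ofReal (r ^ (-((n : ℝ) + s * p))) *
        ENNReal.ofReal (g ‖r⁻¹ • (x - x₀)‖ / ‖r⁻¹ • (x - x₀)‖ ^ ((n : ℝ) + s * p)) := fun x => by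
    rw [hn, ← ENNReal.ofReal_mul (by positivity), Real.div_rpow (norm_nonneg _) hr.le,
      Real.rpow_neg hr.le]
    congr 1
    field_simp
  simp only [e]
  rw [lintegral_const_mul' _ _ ENNReal.ofReal_ne_top, h, ← mul_assoc,
    ← ENNReal.ofReal_mul (by positivity), neg_add, Real.rpow_add hr, Real.rpow_neg hr.le,
    Real.rpow_natCast]
  congr 2
  field_simp

/-- Outside the unit ball `1 + ‖y‖ ≤ 2‖y‖`, so the kernel is dominated by the integrable `(1 +
‖y‖)^{-n-β}`. -/
theorem lintegral_norm_rpow_lt_top {β : ℝ} (hβ : 0 < β) :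
    ∫⁻ y in (ball (0 : E n) 1)ᶜ, ENNReal.ofReal (1 / ‖y‖ ^ ((n : ℝ) + β)) < ∞ := by
  have h := finite_integral_one_add_norm (E := E n) (μ := volume) (r := (n : ℝ) + β)
    (by rw [finrank_euclideanSpace_fin]; linarith)
  have h2 : ∫⁻ y in (ball (0 : E n) 1)ᶜ, ENNReal.ofReal (1 / ‖y‖ ^ ((n : ℝ) + β))
      ≤ ENNReal.ofReal (2 ^ ((n : ℝ) + β)) *
        ∫⁻ y : E n, ENNReal.ofReal ((1 + ‖y‖) ^ (-((n : ℝ) + β))) := by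
    rw [← lintegral_const_mul' _ _ ENNReal.ofReal_ne_top]
    refine (setLIntegral_mono_ae' measurableSet_ball.compl (.of_forall fun y hy => ?_)).trans
      (setLIntegral_le_lintegral _ _)
    have hy1 : 1 ≤ ‖y‖ := by simpa using hy
    rw [← ENNReal.ofReal_mul (by positivity)]
    refine ENNReal.ofReal_le_ofReal ?_
    rw [Real.rpow_neg (by positivity), ← div_eq_mul_inv, ← Real.div_rpow (by norm_num)
      (by positivity), one_div, ← Real.inv_rpow (by positivity)]
    refine Real.rpow_le_rpow (by positivity) ?_ (by positivity)
    rw [inv_eq_one_div, div_le_div_iff₀ (by positivity) (by positivity)]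
    linarith
  exact h2.trans_lt (ENNReal.mul_lt_top ENNReal.ofReal_lt_top h)

/-- The integral of the kernel over the complement of the unit ball. -/
def kernelInt (n : ℕ) (s p : ℝ) : ℝ :=
  (∫⁻ y in (ball (0 : E n) 1)ᶜ, ENNReal.ofReal (1 / ‖y‖ ^ ((n : ℝ) + s * p))).toReal

theorem kernelInt_nonneg : 0 ≤ kernelInt n s p := ENNReal.toReal_nonneg

theorem tailInt_const (hs : 0 < s) (hp : 1 < p) {c : ℝ} (hc : 0 ≤ c) (x₀ : E n) {r : ℝ}
    (hr : 0 < r) : tailInt s p (fun _ => c) x₀ r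
      = ENNReal.ofReal (c ^ (p - 1) * kernelInt n s p * r ^ (-(s * p))) := by
  have hsp : 0 < s * p := by positivity
  have h := lintegral_kernel_scale (s := s) (p := p) x₀ hr (g := fun _ => 1) measurable_const
  rw [← ENNReal.ofReal_toReal (lintegral_norm_rpow_lt_top (n := n) hsp).ne,
    ← ENNReal.ofReal_mul (by positivity)] at h
  have e : ∀ x : E n, ENNReal.ofReal (|c| ^ (p - 1) / ‖x - x₀‖ ^ ((n : ℝ) + s * p))
      = ENNReal.ofReal (c ^ (p - 1)) * ENNReal.ofReal (1 / ‖x - x₀‖ ^ ((n : ℝ) + s * p)) :=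
    fun x => by
      rw [← ENNReal.ofReal_mul (by positivity), mul_one_div, abs_of_nonneg hc]
  rw [tailInt]
  simp only [e]
  rw [lintegral_const_mul' _ _ ENNReal.ofReal_ne_top, h, ← ENNReal.ofReal_mul (by positivity)]
  congr 1
  rw [kernelInt]; ring

/-- The crude constant `2^q` serves both `q < 1` and `q ≥ 1`; this is needed since `p - 1` may be
either. -/
theorem add_rpow_le {a b q : ℝ} (ha : 0 ≤ a) (hb : 0 ≤ b) (hq : 0 < q) :
    (a + b) ^ q ≤ 2 ^ q * (a ^ q + b ^ q) := by
  rcases le_total a b with h | h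
  · calc (a + b) ^ q ≤ (2 * b) ^ q := by gcongr; linarith
      _ = 2 ^ q * b ^ q := Real.mul_rpow (by norm_num) hb
      _ ≤ _ := by gcongr; exact le_add_of_nonneg_left (by positivity)
  · calc (a + b) ^ q ≤ (2 * a) ^ q := by gcongr; linarith
      _ = 2 ^ q * a ^ q := Real.mul_rpow (by norm_num) ha
      _ ≤ _ := by gcongr; exact le_add_of_nonneg_right (by positivity)

theorem tailInt_le_add (hp : 1 < p) {w a b : E n → ℝ} (ha : Measurable a)
    (h : ∀ x, |w x| ≤ |a x| + |b x|) (x₀ : E n) (r : ℝ) :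
    tailInt s p w x₀ r
      ≤ ENNReal.ofReal (2 ^ (p - 1)) * (tailInt s p a x₀ r + tailInt s p b x₀ r) := by
  have hp1 : 0 < p - 1 := by linarith
  rw [tailInt, tailInt, tailInt, ← lintegral_add_left (by fun_prop),
    ← lintegral_const_mul' _ _ ENNReal.ofReal_ne_top]
  refine lintegral_mono fun x => ?_
  rw [← ENNReal.ofReal_add (by positivity) (by positivity), ← ENNReal.ofReal_mul (by positivity)]
  refine ENNReal.ofReal_le_ofReal ?_
  rw [← add_div, ← mul_div_assoc]
  gcongr
  exact (Real.rpow_le_rpow (abs_nonneg _) (h x) hp1.le).trans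
    (add_rpow_le (abs_nonneg _) (abs_nonneg _) hp1)

/-- Away from `x₀` the distances `1 + ‖x‖` and `‖x - x₀‖` are comparable, so the weighted
integrability of `u` controls its tail. -/
theorem tailInt_lt_top (hs : 0 < s) (hp : 1 < p) {u : E n → ℝ}
    (hu : ∫⁻ x, ENNReal.ofReal (|u x| ^ (p - 1) / (1 + ‖x‖) ^ ((n : ℝ) + s * p)) < ∞)
    (x₀ : E n) {r : ℝ} (hr : 0 < r) : tailInt s p u x₀ r < ∞ := by
  have he : 0 ≤ (n : ℝ) + s * p := by positivity
  set C : ℝ := (1 + ‖x₀‖) / r + 1 with hC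
  have hC0 : 0 < C := by positivity
  refine lt_of_le_of_lt ?_ (ENNReal.mul_lt_top (ENNReal.ofReal_lt_top
    (r := C ^ ((n : ℝ) + s * p))) hu)
  rw [← lintegral_const_mul' _ _ ENNReal.ofReal_ne_top]
  refine (setLIntegral_mono_ae' measurableSet_ball.compl (.of_forall fun x hx => ?_)).trans
    (setLIntegral_le_lintegral _ _)
  have hx1 : r ≤ ‖x - x₀‖ := by simpa [dist_eq_norm] using hx
  have hx0 : 0 < ‖x - x₀‖ := by linarith
  rw [← ENNReal.ofReal_mul (by positivity)]
  refine ENNReal.ofReal_le_ofReal ?_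
  rw [← mul_div_assoc, div_le_div_iff₀ (by positivity) (by positivity)]
  have h1 : 1 + ‖x‖ ≤ C * ‖x - x₀‖ := by
    have h2 : ‖x‖ ≤ ‖x₀‖ + ‖x - x₀‖ := by
      simpa using norm_add_le x₀ (x - x₀)
    have h3 : 1 + ‖x₀‖ ≤ (1 + ‖x₀‖) / r * ‖x - x₀‖ := by
      rw [div_mul_eq_mul_div, le_div_iff₀ hr]
      gcongr
    rw [hC]; linarith
  calc |u x| ^ (p - 1) * (1 + ‖x‖) ^ ((n : ℝ) + s * p)
      ≤ |u x| ^ (p - 1) * (C * ‖x - x₀‖) ^ ((n : ℝ) + s * p) := by gcongr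
    _ = _ := by rw [Real.mul_rpow hC0.le hx0.le]; ring

/-- The kernel integral of the admissible growth of the oscillation at exponent `α` is small for
small `α`. -/
theorem exists_exponent (hs : 0 < s) (hp : 1 < p) {α₀ ε : ℝ} (hα₀ : 0 < α₀) (hε : 0 < ε) :
    ∃ α, 0 < α ∧ α ≤ α₀ ∧
      ∫⁻ y in (ball (0 : E n) 1)ᶜ,
        ENNReal.ofReal (((4 * ‖y‖) ^ α - 1) ^ (p - 1) / ‖y‖ ^ ((n : ℝ) + s * p))
      ≤ ENNReal.ofReal ε := by
  have hsp : 0 < s * p := by positivity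
  have hp1 : 0 < p - 1 := by linarith
  -- The cap `a (p - 1) ≤ sp / 2` leaves half of the kernel's decay for integrability. Dominated
  -- convergence along the exponents `a / (m + 1)` then applies, the integrand tending to zero
  -- pointwise.
  set a : ℝ := min α₀ (s * p / 2 / (p - 1)) with ha
  have ha0 : 0 < a := lt_min hα₀ (by positivity)
  have hap : a * (p - 1) ≤ s * p / 2 := by
    rw [← le_div_iff₀ hp1]; exact min_le_right _ _
  set F : ℕ → E n → ℝ≥0∞ := fun m y =>
    ENNReal.ofReal (((4 * ‖y‖) ^ (a / (m + 1)) - 1) ^ (p - 1) / ‖y‖ ^ ((n : ℝ) + s * p)) with hF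
  have hm0 : ∀ m : ℕ, 0 < a / ((m : ℝ) + 1) := fun m => by positivity
  have hm1 : ∀ m : ℕ, a / ((m : ℝ) + 1) ≤ a := fun m => by
    refine div_le_self ha0.le ?_
    have : (0 : ℝ) ≤ m := m.cast_nonneg
    linarith
  have hlim : Filter.Tendsto (fun m => ∫⁻ y in (ball (0 : E n) 1)ᶜ, F m y) Filter.atTop
      (nhds (∫⁻ _ in (ball (0 : E n) 1)ᶜ, 0)) := by
    refine tendsto_lintegral_filter_of_dominated_convergence
      (fun y => ENNReal.ofReal (4 ^ (s * p / 2)) *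
        ENNReal.ofReal (1 / ‖y‖ ^ ((n : ℝ) + s * p / 2))) ?_ ?_ ?_ ?_
    · exact .of_forall fun m => by
        simp only [hF]; fun_prop
    · refine .of_forall fun m => (ae_restrict_mem measurableSet_ball.compl).mono fun y hy => ?_
      have hy1 : 1 ≤ ‖y‖ := by simpa using hy
      have hy0 : 0 < ‖y‖ := by linarith
      simp only [hF]
      rw [← ENNReal.ofReal_mul (by positivity)]
      refine ENNReal.ofReal_le_ofReal ?_
      have h1 : 1 ≤ (4 * ‖y‖) ^ (a / ((m : ℝ) + 1)) :=
        Real.one_le_rpow (by linarith) (hm0 m).le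
      have h2 : ((4 * ‖y‖) ^ (a / ((m : ℝ) + 1)) - 1) ^ (p - 1) ≤ (4 * ‖y‖) ^ (s * p / 2) := by
        calc _ ≤ ((4 * ‖y‖) ^ a) ^ (p - 1) := by
              refine Real.rpow_le_rpow (by linarith) ?_ hp1.le
              have := Real.rpow_le_rpow_of_exponent_le (by linarith : 1 ≤ 4 * ‖y‖) (hm1 m)
              linarith
          _ = (4 * ‖y‖) ^ (a * (p - 1)) := by rw [← Real.rpow_mul (by positivity)]
          _ ≤ _ := Real.rpow_le_rpow_of_exponent_le (by linarith) hap
      calc _ ≤ (4 * ‖y‖) ^ (s * p / 2) / ‖y‖ ^ ((n : ℝ) + s * p) := by gcongr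
        _ = _ := by
          rw [Real.mul_rpow (by norm_num) hy0.le,
            show (n : ℝ) + s * p = (n : ℝ) + s * p / 2 + s * p / 2 by ring,
            Real.rpow_add hy0 _ (s * p / 2)]
          field_simp
    · rw [lintegral_const_mul' _ _ ENNReal.ofReal_ne_top]
      exact (ENNReal.mul_lt_top ENNReal.ofReal_lt_top
        (lintegral_norm_rpow_lt_top (by positivity))).ne
    · refine (ae_restrict_mem measurableSet_ball.compl).mono fun y hy => ?_
      have hy1 : 1 ≤ ‖y‖ := by simpa using hy
      have hy0 : 0 < 4 * ‖y‖ := by linarith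
      rw [← ENNReal.ofReal_zero]
      refine ENNReal.tendsto_ofReal ?_
      have h1 : Filter.Tendsto (fun m : ℕ => a / ((m : ℝ) + 1)) Filter.atTop (nhds 0) := by
        simpa [mul_one_div, div_eq_mul_inv] using
          (tendsto_one_div_add_atTop_nhds_zero_nat (𝕜 := ℝ)).const_mul a
      have h2 : Filter.Tendsto (fun m : ℕ => (4 * ‖y‖) ^ (a / ((m : ℝ) + 1)) - 1)
          Filter.atTop (nhds ((4 * ‖y‖) ^ (0 : ℝ) - 1)) :=
        ((Real.continuousAt_const_rpow hy0.ne').tendsto.comp h1).sub_const 1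
      have h3 := (h2.rpow_const (p := p - 1) (Or.inr hp1.le)).div_const (‖y‖ ^ ((n : ℝ) + s * p))
      simpa [Real.zero_rpow hp1.ne'] using h3
  rw [lintegral_zero] at hlim
  obtain ⟨m, hm⟩ := (hlim.eventually (ge_mem_nhds (ENNReal.ofReal_pos.2 hε))).exists
  exact ⟨a / (m + 1), hm0 m, (hm1 m).trans (min_le_left _ _), hm⟩

/-! ### The growth lemma -/

theorem rpow_eq_mul_rpow_sub_one {x : ℝ} (hx : 0 < x) (a : ℝ) : x ^ a = x * x ^ (a - 1) := by
  rw [mul_comm, ← Real.rpow_add_one hx.ne', sub_add_cancel]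

theorem tailInt_le_of_ae_zero (hp : 1 < p) {w : E n → ℝ} {x₀ : E n} {r ρ : ℝ}
    (h : ∀ᵐ x ∂volume.restrict (ball x₀ ρ), w x = 0) :
    tailInt s p w x₀ r ≤ tailInt s p w x₀ ρ := by
  have hsub : (ball x₀ r)ᶜ ⊆ ball x₀ ρ ∪ (ball x₀ ρ)ᶜ := by simp
  refine (lintegral_mono_set hsub).trans ((lintegral_union_le _ _ _).trans ?_)
  have h0 : ∫⁻ x in ball x₀ ρ,
      ENNReal.ofReal (|w x| ^ (p - 1) / ‖x - x₀‖ ^ ((n : ℝ) + s * p)) = 0 := by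
    refine (lintegral_congr_ae ?_).trans lintegral_zero
    filter_upwards [h] with x hx
    rw [hx, abs_zero, Real.zero_rpow (by linarith), zero_div, ENNReal.ofReal_zero]
  rw [h0, zero_add]
  rfl

/-- The interaction term bounds the excess over `k` from below, if the function lies substantially
below `k` on a large set. -/
theorem mul_lintegral_le_interaction (hs : 0 < s) (hp : 1 < p) {f : E n → ℝ} (hf : Measurable f)
    {x₀ : E n} {ρ k b m : ℝ} (hρ : 0 < ρ) (hb : 0 < b)
    (hv : ENNReal.ofReal m ≤ volume ({x | f x ≤ k - b} ∩ ball x₀ (ρ / 2))) :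
    ENNReal.ofReal (b ^ (p - 1) / ρ ^ ((n : ℝ) + s * p) * m)
        * ∫⁻ x in ball x₀ (ρ / 2), ENNReal.ofReal ((f x - k)⁺)
      ≤ interaction s p (fun x => (f x - k)⁺) (fun x => (f x - k)⁻) (ball x₀ (ρ / 2)) := by
  have hT : MeasurableSet ({x | f x ≤ k - b} ∩ ball x₀ (ρ / 2)) :=
    (measurableSet_le hf measurable_const).inter measurableSet_ball
  rw [← lintegral_const_mul' _ _ ENNReal.ofReal_ne_top]
  refine setLIntegral_mono_ae' measurableSet_ball (.of_forall fun x hx => ?_)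
  rcases le_or_gt (f x) k with hk | hk
  · rw [posPart_eq_zero.2 (by linarith)]; simp
  rw [mul_comm]
  refine mul_le_mul_right ?_ _
  rw [ENNReal.ofReal_mul (by positivity)]
  refine (mul_le_mul_right hv _).trans ?_
  rw [← setLIntegral_const]
  -- The inner integral is restricted to the set where `(f - k)_- ≥ b`; points of the half ball are
  -- at distance at most `ρ` from each other.
  refine (setLIntegral_mono_ae' hT (.of_forall fun y hy => ?_)).trans (setLIntegral_le_lintegral _ _)
  refine ENNReal.ofReal_le_ofReal ?_
  have hy1 : f y ≤ k - b := hy.1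
  have hne : x ≠ y := by rintro rfl; linarith
  have h0 : 0 < ‖x - y‖ := norm_pos_iff.2 (sub_ne_zero.2 hne)
  have h1 : ‖x - y‖ ≤ ρ := by
    have a1 := mem_ball.1 hx
    have a2 := mem_ball.1 hy.2
    rw [← dist_eq_norm]
    have := dist_triangle_right x y x₀
    linarith
  have h2 : b ≤ (f y - k)⁻ := by
    rw [negPart_eq_neg.2 (by linarith)]; linarith
  have h3 := Real.rpow_le_rpow hb.le h2 (by linarith : 0 ≤ p - 1)
  gcongr

/-- The growth lemma: a function below `M` on a ball, which lies below `M - ω / 2` on half of a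
smaller ball, stays away from `M` near the centre. -/
theorem exists_growth (hn : 1 ≤ n) (hs : 0 < s) (hs1 : s < 1) (hp : 1 < p)
    (hH : 1 ≤ H) (hlam : 0 ≤ lam) :
    ∃ δ : ℝ, 0 < δ ∧ δ ≤ 1 / 4 ∧ ∀ (d : ℝ), 0 ≤ d → ∀ (f : E n → ℝ), Measurable f →
      ∀ (x₀ : E n) (ρ : ℝ), 0 < ρ → Cacc s p d H lam f x₀ ρ → ∀ M ω : ℝ, 0 < ω →
      (∀ᵐ x ∂volume.restrict (ball x₀ ρ), f x ≤ M) →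
      ENNReal.ofReal (unitVol n * (ρ / 2) ^ n / 2)
        ≤ volume ({x | f x ≤ M - ω / 2} ∩ ball x₀ (ρ / 2)) →
      ρ ^ (lam + s * p) * d ^ p ≤ (δ * ω) ^ p →
      tailInt s p (fun x => (f x - M)⁺) x₀ ρ
        ≤ ENNReal.ofReal ((δ * ω) ^ (p - 1) * ρ ^ (-(s * p))) →
      ∀ᵐ x ∂volume.restrict (ball x₀ (ρ / 4)), f x ≤ M - δ * ω / 2 := by
  have hV := unitVol_pos n
  have hsp : 0 < s * p := by positivity
  have hp1 : 0 < p - 1 := by linarith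
  have hI := kernelInt_nonneg (n := n) (s := s) (p := p)
  set Λ₀ : ℝ := 2 ^ (p - 1) * (4 ^ (s * p) * kernelInt n s p + 1) with hΛ₀
  have hΛ₀0 : 0 < Λ₀ := by positivity
  -- The iteration will run with `K = δω/2` on `B_{ρ/2}`: halving `δω` costs `2^{p-1}` in the tail
  -- and `2^p` in the datum.
  set Λ : ℝ := 2 ^ (p - 1) * Λ₀ + 2 ^ p with hΛ
  have hΛ0 : 0 < Λ := by positivity
  obtain ⟨θ, hθ, hiter⟩ := exists_iteration_threshold (n := n) (H := H) hn hs hs1 hp hH hlam hΛ0.le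
  -- The summands come from the datum, the `L^p` and the tail term of the Caccioppoli inequality on
  -- `B_{ρ/2} ⊂ B_ρ`.
  set A : ℝ := 1 + 2 ^ p + 2 ^ ((n : ℝ) + s * p) * Λ₀ with hA
  have hA0 : 0 < A := by positivity
  set C : ℝ := H * A * 4 ^ (p - 1) * 2 ^ (n + 1) with hC
  have hC0 : 0 < C := by positivity
  -- The bound `1 / 4` keeps `k = M - δω` at least `ω/4` above `M - ω/2`; the other bound puts the
  -- excess below the threshold `θ (δω/2)^p (ρ/2)^n`.
  set δ : ℝ := min (1 / 4) ((θ / (2 ^ p * 2 ^ n * C)) ^ (1 / (p - 1))) with hδ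
  have hδ0 : 0 < δ := lt_min (by norm_num) (by positivity)
  have hδ4 : δ ≤ 1 / 4 := min_le_left _ _
  have hδθ : C * δ ^ (p - 1) ≤ θ / (2 ^ p * 2 ^ n) := by
    have : δ ^ (p - 1) ≤ θ / (2 ^ p * 2 ^ n * C) := by
      calc δ ^ (p - 1) ≤ ((θ / (2 ^ p * 2 ^ n * C)) ^ (1 / (p - 1))) ^ (p - 1) := by
            gcongr; exact min_le_right _ _
        _ = _ := by
            rw [← Real.rpow_mul (by positivity), one_div_mul_cancel hp1.ne', Real.rpow_one]
    calc C * δ ^ (p - 1) ≤ C * (θ / (2 ^ p * 2 ^ n * C)) := by gcongr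
      _ = _ := by field_simp
  refine ⟨δ, hδ0, hδ4, ?_⟩
  intro d hd f hfm x₀ ρ hρ hf M ω hω hM hvol hdω htail
  set k : ℝ := M - δ * ω with hk
  have hδω : 0 < δ * ω := by positivity
  have hwle : ∀ᵐ x ∂volume.restrict (ball x₀ ρ), (f x - k)⁺ ≤ δ * ω := by
    filter_upwards [hM] with x hx
    exact sup_le (by rw [hk]; linarith) hδω.le
  have hT4 : tailInt s p (fun x => (f x - k)⁺) x₀ (ρ / 4)
      ≤ ENNReal.ofReal (Λ₀ * (δ * ω) ^ (p - 1) * ρ ^ (-(s * p))) := by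
    have h1 := tailInt_le_add (s := s) hp (w := fun x => (f x - k)⁺) (a := fun _ => δ * ω)
      (b := fun x => (f x - M)⁺) measurable_const (fun x => by
        rw [abs_of_nonneg (posPart_nonneg _), abs_of_nonneg (posPart_nonneg _),
          abs_of_nonneg hδω.le]
        have := le_posPart (f x - M)
        exact sup_le (by rw [hk]; linarith)
          (add_nonneg hδω.le (posPart_nonneg _))) x₀ (ρ / 4)
    -- The excess over `M` vanishes almost everywhere in `B_ρ`, so shrinking the excluded ball does
    -- not enlarge its tail.
    have h2 : tailInt s p (fun x => (f x - M)⁺) x₀ (ρ / 4)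
        ≤ tailInt s p (fun x => (f x - M)⁺) x₀ ρ := by
      refine tailInt_le_of_ae_zero hp ?_
      filter_upwards [hM] with x hx
      exact posPart_eq_zero.2 (by linarith)
    refine h1.trans ((mul_le_mul_right (add_le_add_right (h2.trans htail) _) _).trans ?_)
    rw [tailInt_const hs hp hδω.le x₀ (by positivity), ← ENNReal.ofReal_add (by positivity)
      (by positivity), ← ENNReal.ofReal_mul (by positivity)]
    refine ENNReal.ofReal_le_ofReal (le_of_eq ?_)
    rw [hΛ₀, Real.div_rpow hρ.le (by norm_num), Real.rpow_neg (x := 4) (by norm_num)]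
    field_simp
  have hT2 : tailInt s p (fun x => (f x - k)⁺) x₀ (ρ / 2)
      ≤ ENNReal.ofReal (Λ₀ * (δ * ω) ^ (p - 1) * ρ ^ (-(s * p))) :=
    (tailInt_mono hp (fun x => le_rfl) x₀ (by linarith)).trans hT4
  have hball := volume_ball_eq hn x₀ hρ.le
  set c : ℝ := (ω / 4) ^ (p - 1) / ρ ^ ((n : ℝ) + s * p) * (unitVol n * (ρ / 2) ^ n / 2) with hc
  have hc0 : 0 < c := by positivity
  -- The decisive estimate: the interaction term carries `ω^{p-1}` and the right side `(δω)^p`,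
  -- which bounds the `L^1` excess by `δ^p ω` rather than the trivial `δω`.
  have hL1 : (∫⁻ x in ball x₀ (ρ / 2), ENNReal.ofReal ((f x - k)⁺))
      ≤ ENNReal.ofReal (C * ρ ^ n * δ ^ p * ω) := by
    have hlow := mul_lintegral_le_interaction (s := s) hs hp hfm (x₀ := x₀) (k := k) hρ
      (by positivity : 0 < ω / 4) (hvol.trans (measure_mono
        (inter_subset_inter_left _ fun x (hx : f x ≤ M - ω / 2) => by
          change f x ≤ k - ω / 4
          rw [hk]; nlinarith)))
    have hcacc := hf (ρ / 2) ρ (by positivity) (by linarith) le_rfl k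
    have hup : ENNReal.ofReal c * ∫⁻ x in ball x₀ (ρ / 2), ENNReal.ofReal ((f x - k)⁺)
        ≤ ENNReal.ofReal (H * (A * (unitVol n * ρ ^ n) * (δ * ω) ^ p * ρ ^ (-(s * p)))) := by
      refine (hlow.trans (le_add_self.trans hcacc)).trans ?_
      rw [ENNReal.ofReal_mul (p := H) (by linarith)]
      refine mul_le_mul_right ?_ _
      have t1 : ENNReal.ofReal (ρ ^ lam * d ^ p) * volume ({x | k < f x} ∩ ball x₀ ρ)
          ≤ ENNReal.ofReal ((δ * ω) ^ p * ρ ^ (-(s * p)) * (unitVol n * ρ ^ n)) := by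
        rw [ENNReal.ofReal_mul (p := (δ * ω) ^ p * ρ ^ (-(s * p))) (by positivity), ← hball]
        refine mul_le_mul' (ENNReal.ofReal_le_ofReal ?_) (measure_mono inter_subset_right)
        calc ρ ^ lam * d ^ p = ρ ^ (lam + s * p) * d ^ p * ρ ^ (-(s * p)) := by
              rw [mul_right_comm, ← Real.rpow_add hρ]; congr 2; ring
          _ ≤ _ := by gcongr
      have t2 : ENNReal.ofReal (ρ ^ ((1 - s) * p) / (ρ - ρ / 2) ^ p)
          * (∫⁻ x in ball x₀ ρ, ENNReal.ofReal ((f x - k)⁺ ^ p))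
          ≤ ENNReal.ofReal (2 ^ p * ρ ^ (-(s * p)) * ((δ * ω) ^ p * (unitVol n * ρ ^ n))) := by
        rw [ENNReal.ofReal_mul (by positivity)]
        refine mul_le_mul' (ENNReal.ofReal_le_ofReal (le_of_eq ?_)) ?_
        · rw [show ρ - ρ / 2 = ρ / 2 by ring, Real.div_rpow hρ.le (by norm_num),
            show (1 - s) * p = p + -(s * p) by ring, Real.rpow_add hρ]
          field_simp
        · rw [ENNReal.ofReal_mul (by positivity), ← hball, ← setLIntegral_const]
          refine lintegral_mono_ae ?_
          filter_upwards [hwle] with x hx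
          exact ENNReal.ofReal_le_ofReal
            (Real.rpow_le_rpow (posPart_nonneg _) hx (by linarith))
      have t3 : ENNReal.ofReal (ρ ^ ((n : ℝ) + s * p) / (ρ - ρ / 2) ^ ((n : ℝ) + s * p))
          * (∫⁻ x in ball x₀ ρ, ENNReal.ofReal ((f x - k)⁺))
          * tailInt s p (fun x => (f x - k)⁺) x₀ (ρ / 2)
          ≤ ENNReal.ofReal (2 ^ ((n : ℝ) + s * p) * (δ * ω * (unitVol n * ρ ^ n))
            * (Λ₀ * (δ * ω) ^ (p - 1) * ρ ^ (-(s * p)))) := by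
        rw [ENNReal.ofReal_mul (by positivity), ENNReal.ofReal_mul (by positivity)]
        refine mul_le_mul' (mul_le_mul' (ENNReal.ofReal_le_ofReal (le_of_eq ?_)) ?_) hT2
        · rw [show ρ - ρ / 2 = ρ / 2 by ring, Real.div_rpow hρ.le (by norm_num)]
          field_simp
        · rw [ENNReal.ofReal_mul (by positivity), ← hball, ← setLIntegral_const]
          refine lintegral_mono_ae ?_
          filter_upwards [hwle] with x hx
          exact ENNReal.ofReal_le_ofReal hx
      refine (add_le_add (add_le_add t1 t2) t3).trans ?_
      rw [← ENNReal.ofReal_add (by positivity) (by positivity),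
        ← ENNReal.ofReal_add (by positivity) (by positivity)]
      refine ENNReal.ofReal_le_ofReal (le_of_eq ?_)
      have e : (δ * ω) ^ p = δ * ω * (δ * ω) ^ (p - 1) := rpow_eq_mul_rpow_sub_one hδω p
      rw [hA, e]; ring
    have hcinv : ENNReal.ofReal c⁻¹ * ENNReal.ofReal c = 1 := by
      rw [← ENNReal.ofReal_mul (by positivity), inv_mul_cancel₀ hc0.ne', ENNReal.ofReal_one]
    calc _ = ENNReal.ofReal c⁻¹ * (ENNReal.ofReal c
          * ∫⁻ x in ball x₀ (ρ / 2), ENNReal.ofReal ((f x - k)⁺)) := by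
          rw [← mul_assoc, hcinv, one_mul]
      _ ≤ _ := mul_le_mul_right hup _
      _ = _ := by
          rw [← ENNReal.ofReal_mul (by positivity)]
          congr 1
          have e1 : ω ^ p = ω * ω ^ (p - 1) := rpow_eq_mul_rpow_sub_one hω p
          rw [hc, hC, Real.rpow_add hρ, Real.rpow_natCast, Real.mul_rpow hδ0.le hω.le, e1,
            Real.div_rpow hω.le (by norm_num), Real.rpow_neg hρ.le, div_pow]
          field_simp
          ring
  have hiter' := hiter d hd f hfm x₀ (ρ / 2) (by positivity) (hf.mono (by linarith)) k
    (δ * ω / 2) (by positivity) ?_ ?_ ?_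
  · rw [show ρ / 4 = ρ / 2 / 2 by ring]
    filter_upwards [hiter'] with x hx
    rw [hk] at hx; linarith
  · have e : (δ * ω) ^ p = 2 ^ p * (δ * ω / 2) ^ p := by
      rw [← Real.mul_rpow (by norm_num) (by positivity)]; congr 1; ring
    calc (ρ / 2) ^ (lam + s * p) * d ^ p ≤ ρ ^ (lam + s * p) * d ^ p := by
          gcongr; linarith
      _ ≤ 2 ^ p * (δ * ω / 2) ^ p := e ▸ hdω
      _ ≤ _ := by
          gcongr
          rw [hΛ]; exact le_add_of_nonneg_left (by positivity)
  · rw [show ρ / 2 / 2 = ρ / 4 by ring]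
    refine hT4.trans (ENNReal.ofReal_le_ofReal ?_)
    have e : (δ * ω) ^ (p - 1) = 2 ^ (p - 1) * (δ * ω / 2) ^ (p - 1) := by
      rw [← Real.mul_rpow (by norm_num) (by positivity)]; congr 1; ring
    have e2 : ρ ^ (-(s * p)) ≤ (ρ / 2) ^ (-(s * p)) :=
      Real.rpow_le_rpow_of_nonpos (by positivity) (by linarith) (by linarith)
    calc Λ₀ * (δ * ω) ^ (p - 1) * ρ ^ (-(s * p))
        = 2 ^ (p - 1) * Λ₀ * (δ * ω / 2) ^ (p - 1) * ρ ^ (-(s * p)) := by rw [e]; ring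
      _ ≤ _ := by
          gcongr
          rw [hΛ]; exact le_add_of_nonneg_right (by positivity)
  -- Since `(f - k)_+ ≤ δω`, the `L^1` bound becomes an `L^p` bound with the additional small factor
  -- `δ^{p-1}`.
  · calc (∫⁻ x in ball x₀ (ρ / 2), ENNReal.ofReal ((f x - k)⁺ ^ p))
        ≤ ∫⁻ x in ball x₀ (ρ / 2), ENNReal.ofReal ((δ * ω) ^ (p - 1))
            * ENNReal.ofReal ((f x - k)⁺) := by
          refine lintegral_mono_ae ?_
          filter_upwards [ae_restrict_of_ae_restrict_of_subset
            (ball_subset_ball (by linarith : ρ / 2 ≤ ρ)) hwle] with x hx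
          rw [← ENNReal.ofReal_mul (by positivity)]
          refine ENNReal.ofReal_le_ofReal ?_
          have h0 := posPart_nonneg (f x - k)
          rcases h0.eq_or_lt with h | h
          · rw [← h, Real.zero_rpow (by linarith), mul_zero]
          · calc (f x - k)⁺ ^ p = (f x - k)⁺ ^ (p - 1) * (f x - k)⁺ := by
                  rw [← Real.rpow_add_one h.ne']; congr 1; ring
              _ ≤ _ := by gcongr
      _ = ENNReal.ofReal ((δ * ω) ^ (p - 1))
            * ∫⁻ x in ball x₀ (ρ / 2), ENNReal.ofReal ((f x - k)⁺) :=
          lintegral_const_mul' _ _ ENNReal.ofReal_ne_top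
      _ ≤ ENNReal.ofReal ((δ * ω) ^ (p - 1)) * ENNReal.ofReal (C * ρ ^ n * δ ^ p * ω) := by
          gcongr
      _ ≤ _ := by
          rw [← ENNReal.ofReal_mul (by positivity)]
          refine ENNReal.ofReal_le_ofReal ?_
          have e1 : (δ * ω) ^ (p - 1) * (C * ρ ^ n * δ ^ p * ω)
              = C * δ ^ (p - 1) * ((δ * ω) ^ p * ρ ^ n) := by
            have e2 : ω ^ p = ω * ω ^ (p - 1) := rpow_eq_mul_rpow_sub_one hω p
            rw [Real.mul_rpow hδ0.le hω.le, Real.mul_rpow hδ0.le hω.le, e2]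
            ring
          rw [e1]
          calc _ ≤ θ / (2 ^ p * 2 ^ n) * ((δ * ω) ^ p * ρ ^ n) := by gcongr
            _ = _ := by
              rw [Real.div_rpow hδω.le (by norm_num), div_pow]
              field_simp

/-! ### Local boundedness -/

/-- Local upper bounds for functions satisfying Caccioppoli inequalities. -/
theorem Cacc.exists_ae_le (hn : 1 ≤ n) (hs : 0 < s) (hs1 : s < 1) (hp : 1 < p)
    (hH : 1 ≤ H) (hlam : 0 ≤ lam) (hd : 0 ≤ d) {f : E n → ℝ} (hfm : Measurable f) {x₀ : E n}
    {R : ℝ} (hR : 0 < R) (hf : Cacc s p d H lam f x₀ R)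
    (htail : tailInt s p f x₀ (R / 2) < ∞)
    (hLp : (∫⁻ x in ball x₀ R, ENNReal.ofReal (|f x| ^ p)) < ∞) :
    ∃ K, ∀ᵐ x ∂volume.restrict (ball x₀ (R / 2)), f x ≤ K := by
  obtain ⟨θ, hθ, hiter⟩ :=
    exists_iteration_threshold (n := n) (H := H) hn hs hs1 hp hH hlam zero_le_one
  have hpos : ∀ x, (f x - 0)⁺ ≤ |f x| := fun x => by
    rw [sub_zero]; exact sup_le (le_abs_self _) (abs_nonneg _)
  have htail' : tailInt s p (fun x => (f x - 0)⁺) x₀ (R / 2) < ∞ :=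
    (tailInt_mono hp (fun x => by rw [abs_of_nonneg (posPart_nonneg _)]; exact hpos x)
      x₀ le_rfl).trans_lt htail
  have hLp' : (∫⁻ x in ball x₀ R, ENNReal.ofReal ((f x - 0)⁺ ^ p)) < ∞ :=
    (lintegral_mono fun x => ENNReal.ofReal_le_ofReal
      (Real.rpow_le_rpow (posPart_nonneg _) (hpos x) (by linarith))).trans_lt hLp
  set t := (tailInt s p (fun x => (f x - 0)⁺) x₀ (R / 2)).toReal with ht
  set y := (∫⁻ x in ball x₀ R, ENNReal.ofReal ((f x - 0)⁺ ^ p)).toReal with hy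
  have h1 := tendsto_rpow_atTop (by linarith : 0 < p)
  have h2 := tendsto_rpow_atTop (by linarith : 0 < p - 1)
  -- At the level zero, with `Λ = 1`, all hypotheses of the iteration hold once `K` is large.
  obtain ⟨K, hK0, hK1, hK2, hK3⟩ := ((Filter.eventually_gt_atTop (0 : ℝ)).and
    ((h1.eventually_ge_atTop (R ^ (lam + s * p) * d ^ p)).and
      ((h2.eventually_ge_atTop (t / R ^ (-(s * p)))).and
        (h1.eventually_ge_atTop (y / (θ * R ^ n)))))).exists
  refine ⟨0 + K, hiter d hd f hfm x₀ R hR hf 0 K hK0 (by simpa using hK1) ?_ ?_⟩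
  · rw [← ENNReal.ofReal_toReal htail'.ne]
    refine ENNReal.ofReal_le_ofReal ?_
    rw [div_le_iff₀ (by positivity)] at hK2
    rw [one_mul]; exact hK2
  · rw [← ENNReal.ofReal_toReal hLp'.ne]
    refine ENNReal.ofReal_le_ofReal ?_
    rw [div_le_iff₀ (by positivity)] at hK3
    linarith

/-! ### Oscillation decay -/

/-- The inductive control of the oscillation of `u`: it lies between `m` and `M` on `B_ρ(x₀)`, and
leaves this interval by a controlled amount on `B_R(x₀)`. The last two fields say that `ρ` is so
small that the lower order terms and the tail, bounded in terms of `L` on `B_R(x₀)`, are small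
relative to `ω`. -/
structure OscBound (s p α δ L R : ℝ) (u : E n → ℝ) (x₀ : E n) (ω ρ m M : ℝ) : Prop where
  radius_pos : 0 < ρ
  radius_le : ρ ≤ R
  width_pos : 0 < ω
  lower : -L ≤ m
  upper : M ≤ L
  width : M - m = ω
  near : ∀ᵐ x ∂volume.restrict (ball x₀ ρ), m ≤ u x ∧ u x ≤ M
  far : ∀ᵐ x ∂volume.restrict (ball x₀ R), ρ ≤ ‖x - x₀‖ →
    m - u x ≤ ω * ((4 * (‖x - x₀‖ / ρ)) ^ α - 1) ∧ u x - M ≤ ω * ((4 * (‖x - x₀‖ / ρ)) ^ α - 1)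
  datum_small : ρ ^ (s * p) * L ^ p ≤ (δ * ω) ^ p * R ^ (s * p)
  tail_small : 2 ^ p * (1 + kernelInt n s p) * L ^ (p - 1) * ρ ^ (s * p)
    ≤ (δ * ω) ^ (p - 1) * R ^ (s * p)

variable {α δ L R : ℝ} {u : E n → ℝ} {x₀ : E n} {ω ρ m M : ℝ}

theorem OscBound.neg (h : OscBound s p α δ L R u x₀ ω ρ m M) :
    OscBound s p α δ L R (fun x => -u x) x₀ ω ρ (-M) (-m) where
  radius_pos := h.radius_pos
  radius_le := h.radius_le
  width_pos := h.width_pos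
  lower := neg_le_neg h.upper
  upper := by linarith [h.lower]
  width := by linarith [h.width]
  near := by
    filter_upwards [h.near] with x hx
    exact ⟨neg_le_neg hx.2, neg_le_neg hx.1⟩
  far := by
    filter_upwards [h.far] with x hx hxρ
    have := hx hxρ
    constructor <;> linarith
  datum_small := h.datum_small
  tail_small := h.tail_small

/-- The far bound reproduces itself exactly: with `ω` and `ρ` replaced by `4^{-α} ω` and `ρ / 4`, it
grows by `(1 - 4^{-α}) ω`, the amount by which `M` drops. The smallness conditions persist because
`ρ^{sp}` shrinks by `4^{-sp}`, at least as fast as `ω^p` and `ω^{p-1}` when `α ≤ s`. -/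
theorem OscBound.shrink_upper (hp : 1 < p) (hα : 0 < α) (hαs : α ≤ s) (hδ : 0 < δ)
    (hL : 0 < L) (h : OscBound s p α δ L R u x₀ ω ρ m M)
    (hu : ∀ᵐ x ∂volume.restrict (ball x₀ (ρ / 4)), u x ≤ M - (1 - 4 ^ (-α)) * ω) :
    OscBound s p α δ L R u x₀ (4 ^ (-α) * ω) (ρ / 4) m (M - (1 - 4 ^ (-α)) * ω) := by
  have hρ := h.radius_pos
  have hω := h.width_pos
  have hR : 0 < R := hρ.trans_le h.radius_le
  have hα1 : (4 : ℝ) ^ (-α) ≤ 1 := Real.rpow_le_one_of_one_le_of_nonpos (by norm_num) (by linarith)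
  have hI := kernelInt_nonneg (n := n) (s := s) (p := p)
  have h4 : (4 : ℝ) ^ (-α) * 4 ^ α = 1 := by
    rw [← Real.rpow_add (by norm_num), neg_add_cancel, Real.rpow_zero]
  have hscale : ∀ q, 0 ≤ q → α * q ≤ s * p → ∀ X Y : ℝ, 0 ≤ X → X * ρ ^ (s * p) ≤ (δ * ω) ^ q * Y →
      X * (ρ / 4) ^ (s * p) ≤ (δ * (4 ^ (-α) * ω)) ^ q * Y := by
    intro q hq hαq X Y hX hXY
    have e1 : (δ * (4 ^ (-α) * ω)) ^ q = 4 ^ (-(α * q)) * (δ * ω) ^ q := by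
      rw [show δ * (4 ^ (-α) * ω) = 4 ^ (-α) * (δ * ω) by ring,
        Real.mul_rpow (by positivity) (by positivity), ← Real.rpow_mul (by norm_num), neg_mul]
    have e2 : (ρ / 4) ^ (s * p) = 4 ^ (-(s * p)) * ρ ^ (s * p) := by
      rw [Real.div_rpow hρ.le (by norm_num), Real.rpow_neg (x := 4) (by norm_num)]
      field_simp
    have e3 : (4 : ℝ) ^ (-(s * p)) ≤ 4 ^ (-(α * q)) :=
      Real.rpow_le_rpow_of_exponent_le (by norm_num) (by linarith)
    rw [e1, e2]
    calc X * (4 ^ (-(s * p)) * ρ ^ (s * p)) = 4 ^ (-(s * p)) * (X * ρ ^ (s * p)) := by ring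
      _ ≤ 4 ^ (-(α * q)) * (X * ρ ^ (s * p)) := by gcongr
      _ ≤ 4 ^ (-(α * q)) * ((δ * ω) ^ q * Y) := by gcongr
      _ = _ := by ring
  have hdec : 0 ≤ (1 - (4 : ℝ) ^ (-α)) * ω := mul_nonneg (by linarith) hω.le
  refine ⟨by positivity, by linarith [h.radius_le], by positivity, h.lower,
    by linarith [h.upper], by linarith [h.width], ?_, ?_, ?_, ?_⟩
  · filter_upwards [hu, ae_restrict_of_ae_restrict_of_subset
      (ball_subset_ball (by linarith : ρ / 4 ≤ ρ)) h.near] with x h1 h2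
    exact ⟨h2.1, h1⟩
  · have hnear : ∀ᵐ x ∂volume.restrict (ball x₀ R), x ∈ ball x₀ ρ → m ≤ u x ∧ u x ≤ M :=
      ae_restrict_of_ae ((ae_restrict_iff' measurableSet_ball).1 h.near)
    filter_upwards [h.far, hnear] with x h1 h2 hx
    have hx0 : 0 < ‖x - x₀‖ := by linarith
    have e : 4 ^ (-α) * ω * ((4 * (‖x - x₀‖ / (ρ / 4))) ^ α - 1)
        = ω * (4 * (‖x - x₀‖ / ρ)) ^ α - 4 ^ (-α) * ω := by
      rw [show 4 * (‖x - x₀‖ / (ρ / 4)) = 4 * (4 * (‖x - x₀‖ / ρ)) by field_simp,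
        Real.mul_rpow (by norm_num) (by positivity)]
      linear_combination ω * (4 * (‖x - x₀‖ / ρ)) ^ α * h4
    rw [e]
    by_cases hxρ : ρ ≤ ‖x - x₀‖
    · have := h1 hxρ
      constructor <;> linarith
    -- In the annulus between `ρ / 4` and `ρ` the old bound `u ≤ M` holds, and the factor `4` inside
    -- the power leaves room for the drop of `M`.
    · have h3 := h2 (by rw [mem_ball, dist_eq_norm]; linarith)
      have h5 : 1 ≤ (4 * (‖x - x₀‖ / ρ)) ^ α := by
        refine Real.one_le_rpow ?_ hα.le
        rw [← mul_div_assoc, le_div_iff₀ hρ]; linarith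
      have h6 : ω ≤ ω * (4 * (‖x - x₀‖ / ρ)) ^ α := le_mul_of_one_le_right hω.le h5
      constructor <;> linarith
  · have := hscale p (by linarith) (by nlinarith) (L ^ p) (R ^ (s * p)) (by positivity)
      (by linarith [h.datum_small])
    linarith
  · exact hscale (p - 1) (by linarith) (by nlinarith) _ (R ^ (s * p)) (by positivity) h.tail_small

/-- The tail of the excess over `M` is small under `OscBound`. -/
theorem OscBound.tailInt_le (hs : 0 < s) (hp : 1 < p) (hα : 0 < α) (hδ : 0 < δ) (hL : 0 < L)
    (hum : Measurable u) (h : OscBound s p α δ L R u x₀ ω ρ m M)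
    (hα' : ∫⁻ y in (ball (0 : E n) 1)ᶜ,
        ENNReal.ofReal (((4 * ‖y‖) ^ α - 1) ^ (p - 1) / ‖y‖ ^ ((n : ℝ) + s * p))
      ≤ ENNReal.ofReal (δ ^ (p - 1) / 2))
    (htail : tailInt s p u x₀ R ≤ ENNReal.ofReal (L ^ (p - 1) * R ^ (-(s * p)))) :
    tailInt s p (fun x => (u x - M)⁺) x₀ ρ
      ≤ ENNReal.ofReal ((δ * ω) ^ (p - 1) * ρ ^ (-(s * p))) := by
  have hρ := h.radius_pos
  have hω := h.width_pos
  have hR : 0 < R := hρ.trans_le h.radius_le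
  have hp1 : 0 < p - 1 := by linarith
  have hI := kernelInt_nonneg (n := n) (s := s) (p := p)
  have hML : -L ≤ M := by linarith [h.lower, h.width]
  -- The tail splits at `R`: inside, the far bound and the choice of `α` apply; outside, `(u - M)_+
  -- ≤ |u| + L`. Each part receives half of the allowance.
  have hsub : (ball x₀ ρ)ᶜ ⊆ (ball x₀ R ∩ (ball x₀ ρ)ᶜ) ∪ (ball x₀ R)ᶜ := by
    intro x hx
    by_cases hxR : x ∈ ball x₀ R
    · exact Or.inl ⟨hxR, hx⟩
    · exact Or.inr hxR
  have hnear : ∫⁻ x in ball x₀ R ∩ (ball x₀ ρ)ᶜ,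
      ENNReal.ofReal (|(u x - M)⁺| ^ (p - 1) / ‖x - x₀‖ ^ ((n : ℝ) + s * p))
      ≤ ENNReal.ofReal (ω ^ (p - 1) * (ρ ^ (-(s * p)) * (δ ^ (p - 1) / 2))) := by
    have hsc := lintegral_kernel_scale (n := n) (s := s) (p := p) x₀ hρ
      (g := fun t => ((4 * t) ^ α - 1) ^ (p - 1)) (by fun_prop)
    calc _ ≤ ∫⁻ x in ball x₀ R ∩ (ball x₀ ρ)ᶜ, ENNReal.ofReal (ω ^ (p - 1)) *
          ENNReal.ofReal (((4 * (‖x - x₀‖ / ρ)) ^ α - 1) ^ (p - 1)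
            / ‖x - x₀‖ ^ ((n : ℝ) + s * p)) := by
          refine setLIntegral_mono_ae' (measurableSet_ball.inter measurableSet_ball.compl) ?_
          have hfar := (ae_restrict_iff' measurableSet_ball).1 h.far
          filter_upwards [hfar] with x hx hxm
          have hxρ : ρ ≤ ‖x - x₀‖ := by simpa [dist_eq_norm] using hxm.2
          have h2 := (hx hxm.1 hxρ).2
          have h5 : 1 ≤ (4 * (‖x - x₀‖ / ρ)) ^ α := by
            refine Real.one_le_rpow ?_ hα.le
            rw [← mul_div_assoc, le_div_iff₀ hρ]; linarith
          have h6 : (u x - M)⁺ ≤ ω * ((4 * (‖x - x₀‖ / ρ)) ^ α - 1) :=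
            sup_le h2 (mul_nonneg hω.le (by linarith))
          rw [← ENNReal.ofReal_mul (by positivity), abs_of_nonneg (posPart_nonneg _)]
          refine ENNReal.ofReal_le_ofReal ?_
          rw [← mul_div_assoc, ← Real.mul_rpow hω.le (by linarith)]
          have h7 := Real.rpow_le_rpow (posPart_nonneg _) h6 hp1.le
          gcongr
      _ ≤ ∫⁻ x in (ball x₀ ρ)ᶜ, ENNReal.ofReal (ω ^ (p - 1)) *
          ENNReal.ofReal (((4 * (‖x - x₀‖ / ρ)) ^ α - 1) ^ (p - 1)
            / ‖x - x₀‖ ^ ((n : ℝ) + s * p)) := lintegral_mono_set inter_subset_right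
      _ ≤ _ := by
          rw [lintegral_const_mul' _ _ ENNReal.ofReal_ne_top, hsc,
            ENNReal.ofReal_mul (by positivity), ENNReal.ofReal_mul (by positivity)]
          gcongr
  have hfar : tailInt s p (fun x => (u x - M)⁺) x₀ R
      ≤ ENNReal.ofReal ((δ * ω) ^ (p - 1) * ρ ^ (-(s * p)) / 2) := by
    have h1 := tailInt_le_add (s := s) hp (w := fun x => (u x - M)⁺) (a := u)
      (b := fun _ => L) hum (fun x => by
        rw [abs_of_nonneg (posPart_nonneg _), abs_of_nonneg hL.le]
        have := le_abs_self (u x)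
        exact sup_le (by linarith) (by positivity)) x₀ R
    refine h1.trans ((mul_le_mul_right (add_le_add_left htail _) _).trans ?_)
    rw [tailInt_const hs hp hL.le x₀ hR, ← ENNReal.ofReal_add (by positivity) (by positivity),
      ← ENNReal.ofReal_mul (by positivity)]
    refine ENNReal.ofReal_le_ofReal ?_
    have h2 := h.tail_small
    rw [rpow_eq_mul_rpow_sub_one (by norm_num : (0 : ℝ) < 2) p] at h2
    rw [Real.rpow_neg hR.le, Real.rpow_neg hρ.le, ← div_eq_mul_inv, ← div_eq_mul_inv,
      ← div_eq_mul_inv, ← add_div, ← mul_div_assoc, div_div, div_le_div_iff₀ (by positivity)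
      (by positivity)]
    linarith
  refine (lintegral_mono_set hsub).trans ((lintegral_union_le _ _ _).trans
    ((add_le_add hnear hfar).trans ?_))
  rw [← ENNReal.ofReal_add (by positivity) (by positivity)]
  refine ENNReal.ofReal_le_ofReal (le_of_eq ?_)
  rw [Real.mul_rpow hδ.le hω.le]
  ring

theorem half_le_volume_or (hn : 1 ≤ n) (u : E n → ℝ) (x₀ : E n) {r : ℝ} (hr : 0 < r) (a : ℝ) :
    ENNReal.ofReal (unitVol n * r ^ n / 2) ≤ volume ({x | u x ≤ a} ∩ ball x₀ r) ∨
      ENNReal.ofReal (unitVol n * r ^ n / 2) ≤ volume ({x | -u x ≤ -a} ∩ ball x₀ r) := by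
  by_contra! hcon
  have hV := unitVol_pos n
  have h1 : volume (ball x₀ r)
      ≤ volume ({x | u x ≤ a} ∩ ball x₀ r) + volume ({x | -u x ≤ -a} ∩ ball x₀ r) := by
    refine (measure_mono fun x hx => ?_).trans (measure_union_le _ _)
    rcases le_total (u x) a with h | h
    · exact Or.inl ⟨h, hx⟩
    · exact Or.inr ⟨neg_le_neg h, hx⟩
  have h2 := h1.trans_lt (ENNReal.add_lt_add hcon.1 hcon.2)
  rw [volume_ball_eq hn x₀ hr.le, ← ENNReal.ofReal_add (by positivity) (by positivity),
    add_halves] at h2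
  exact lt_irrefl _ h2

/-- Decay of the oscillation on dyadic balls. -/
theorem exists_oscillation_decay (hn : 1 ≤ n) (hs : 0 < s) (hs1 : s < 1) (hp : 1 < p)
    (hH : 1 ≤ H) (hlam : 0 ≤ lam) :
    ∃ α κ : ℝ, 0 < α ∧ α < 1 ∧ 0 < κ ∧ κ ≤ 1 ∧ ∀ (d : ℝ), 0 ≤ d → ∀ (u : E n → ℝ),
      Measurable u → ∀ (x₀ : E n) (R : ℝ), 0 < R → Cacc s p d H lam u x₀ R →
      Cacc s p d H lam (fun x => -u x) x₀ R → ∀ L : ℝ, 0 < L →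
      (∀ᵐ x ∂volume.restrict (ball x₀ R), |u x| ≤ L) →
      R ^ (lam + s * p) * d ^ p ≤ L ^ p →
      tailInt s p u x₀ R ≤ ENNReal.ofReal (L ^ (p - 1) * R ^ (-(s * p))) →
      ∀ j : ℕ, ∃ m M : ℝ, -L ≤ m ∧ M ≤ L ∧ M - m = (4 ^ (-α)) ^ j * (2 * L) ∧
        ∀ᵐ x ∂volume.restrict (ball x₀ (κ * R / 4 ^ j)), m ≤ u x ∧ u x ≤ M := by
  obtain ⟨δ, hδ, hδ4, hgrowth⟩ := exists_growth (n := n) (H := H) hn hs hs1 hp hH hlam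
  have hsp : 0 < s * p := by positivity
  have hp1 : 0 < p - 1 := by linarith
  have hI := kernelInt_nonneg (n := n) (s := s) (p := p)
  have hlog : 0 < Real.log 4 := Real.log_pos (by norm_num)
  -- The bound `s / 2` serves `shrink_upper`, the bound with `log 4` makes `1 - 4^{-α}` at most the
  -- relative drop `δ / 2` of the growth lemma, and the kernel bound serves `tailInt_le`.
  obtain ⟨α, hα, hαle, hα'⟩ := exists_exponent (n := n) (s := s) (p := p) hs hp
    (lt_min (half_pos hs) (by positivity) : 0 < min (s / 2) (δ / (4 * Real.log 4)))
    (by positivity : 0 < δ ^ (p - 1) / 2)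
  have hαs : α ≤ s / 2 := hαle.trans (min_le_left _ _)
  have hαδ : 1 - (4 : ℝ) ^ (-α) ≤ δ / 2 := by
    have h1 : α * Real.log 4 ≤ δ / 4 := by
      have := hαle.trans (min_le_right _ _)
      rw [le_div_iff₀ (by positivity)] at this
      linarith
    have h2 : (4 : ℝ) ^ (-α) = Real.exp (Real.log 4 * -α) := Real.rpow_def_of_pos (by norm_num) _
    have h3 := Real.add_one_le_exp (Real.log 4 * -α)
    rw [h2]; linarith
  -- The starting radius is `κR` with `κ^{sp} = B`, small enough for both smallness conditions when
  -- `ω = 2L`.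
  set B : ℝ := min (δ ^ p) (δ ^ (p - 1) / (2 ^ p * (1 + kernelInt n s p))) with hB
  have hB0 : 0 < B := lt_min (by positivity) (by positivity)
  have hB1 : B ≤ 1 := (min_le_left _ _).trans
    (Real.rpow_le_one hδ.le (by linarith) (by linarith))
  set κ : ℝ := B ^ (1 / (s * p)) with hκ
  have hκ0 : 0 < κ := by positivity
  have hκ1 : κ ≤ 1 := Real.rpow_le_one hB0.le hB1 (by positivity)
  have hκB : κ ^ (s * p) = B := by
    rw [hκ, ← Real.rpow_mul hB0.le, one_div_mul_cancel hsp.ne', Real.rpow_one]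
  refine ⟨α, κ, hα, by linarith, hκ0, hκ1, ?_⟩
  intro d hd u hum x₀ R hR hcp hcm L hL hbd hdL htail
  have upper : ∀ (f : E n → ℝ), Measurable f → Cacc s p d H lam f x₀ R →
      tailInt s p f x₀ R ≤ ENNReal.ofReal (L ^ (p - 1) * R ^ (-(s * p))) →
      ∀ ω ρ m M, OscBound s p α δ L R f x₀ ω ρ m M →
      ENNReal.ofReal (unitVol n * (ρ / 2) ^ n / 2)
        ≤ volume ({x | f x ≤ M - ω / 2} ∩ ball x₀ (ρ / 2)) →
      OscBound s p α δ L R f x₀ (4 ^ (-α) * ω) (ρ / 4) m (M - (1 - 4 ^ (-α)) * ω) := by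
    intro f hfm hf hft ω ρ m M ho hv
    have hρ := ho.radius_pos
    have hω := ho.width_pos
    refine ho.shrink_upper hp hα (by linarith) hδ hL ?_
    have hd' : ρ ^ (lam + s * p) * d ^ p ≤ (δ * ω) ^ p := by
      have h1 : ρ ^ (lam + s * p) * R ^ (s * p) ≤ R ^ (lam + s * p) * ρ ^ (s * p) := by
        rw [Real.rpow_add hρ, Real.rpow_add hR]
        calc _ = ρ ^ lam * (ρ ^ (s * p) * R ^ (s * p)) := by ring
          _ ≤ R ^ lam * (ρ ^ (s * p) * R ^ (s * p)) := by gcongr; exact ho.radius_le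
          _ = _ := by ring
      have h2 : ρ ^ (lam + s * p) * d ^ p * R ^ (s * p) ≤ (δ * ω) ^ p * R ^ (s * p) := by
        calc _ = ρ ^ (lam + s * p) * R ^ (s * p) * d ^ p := by ring
          _ ≤ R ^ (lam + s * p) * ρ ^ (s * p) * d ^ p := by gcongr
          _ = ρ ^ (s * p) * (R ^ (lam + s * p) * d ^ p) := by ring
          _ ≤ ρ ^ (s * p) * L ^ p := by gcongr
          _ ≤ _ := ho.datum_small
      exact le_of_mul_le_mul_right h2 (by positivity)
    have hg := hgrowth d hd f hfm x₀ ρ hρ (hf.mono ho.radius_le) M ω hω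
      (ho.near.mono fun x hx => hx.2) hv hd' (ho.tailInt_le hs hp hα hδ hL hfm hα' hft)
    filter_upwards [hg] with x hx
    have : (1 - (4 : ℝ) ^ (-α)) * ω ≤ δ / 2 * ω := by gcongr
    linarith
  have hstart : OscBound s p α δ L R u x₀ (2 * L) (κ * R) (-L) L := by
    have hκR : κ * R ≤ R := mul_le_of_le_one_left hR.le hκ1
    refine ⟨by positivity, hκR, by positivity, le_rfl, le_rfl, by ring, ?_, ?_, ?_, ?_⟩
    · filter_upwards [ae_restrict_of_ae_restrict_of_subset (ball_subset_ball hκR) hbd] with x hx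
      exact abs_le.1 hx
    · filter_upwards [hbd] with x hx hxρ
      have h1 := abs_le.1 hx
      have h2 : 1 ≤ (4 * (‖x - x₀‖ / (κ * R))) ^ α := by
        refine Real.one_le_rpow ?_ hα.le
        have : 0 < κ * R := by positivity
        rw [← mul_div_assoc, le_div_iff₀ this]; linarith
      have h3 : 0 ≤ 2 * L * ((4 * (‖x - x₀‖ / (κ * R))) ^ α - 1) :=
        mul_nonneg (by positivity) (by linarith)
      constructor <;> linarith
    · have h1 : κ ^ (s * p) ≤ δ ^ p := hκB ▸ min_le_left _ _
      rw [Real.mul_rpow hκ0.le hR.le, Real.mul_rpow hδ.le (by positivity)]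
      calc κ ^ (s * p) * R ^ (s * p) * L ^ p ≤ δ ^ p * R ^ (s * p) * (2 * L) ^ p := by
            gcongr; linarith
        _ = _ := by ring
    · have h1 : κ ^ (s * p) * (2 ^ p * (1 + kernelInt n s p)) ≤ δ ^ (p - 1) := by
        rw [← le_div_iff₀ (by positivity)]
        exact hκB ▸ min_le_right _ _
      rw [Real.mul_rpow hκ0.le hR.le, Real.mul_rpow hδ.le (by positivity)]
      calc _ = κ ^ (s * p) * (2 ^ p * (1 + kernelInt n s p)) * L ^ (p - 1) * R ^ (s * p) := by ring
        _ ≤ δ ^ (p - 1) * (2 * L) ^ (p - 1) * R ^ (s * p) := by gcongr; linarith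
  have htail' : tailInt s p (fun x => -u x) x₀ R
      ≤ ENNReal.ofReal (L ^ (p - 1) * R ^ (-(s * p))) :=
    (tailInt_mono hp (fun x => (abs_neg _).le) x₀ le_rfl).trans htail
  have hall : ∀ j : ℕ, ∃ m M : ℝ,
      OscBound s p α δ L R u x₀ ((4 ^ (-α)) ^ j * (2 * L)) (κ * R / 4 ^ j) m M := by
    intro j
    induction j with
    | zero => exact ⟨-L, L, by simpa using hstart⟩
    | succ j ih =>
      obtain ⟨m, M, ho⟩ := ih
      have e1 : (4 ^ (-α)) ^ (j + 1) * (2 * L) = 4 ^ (-α) * ((4 ^ (-α)) ^ j * (2 * L)) := by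
        rw [pow_succ]; ring
      have e2 : κ * R / 4 ^ (j + 1) = κ * R / 4 ^ j / 4 := by rw [pow_succ, div_div]
      rw [e1, e2]
      set ω := (4 ^ (-α)) ^ j * (2 * L)
      -- `M - ω/2` is the midpoint of `[m, M]`: in one case `M` is lowered, in the other `m` is
      -- raised by passing to `-u`.
      rcases half_le_volume_or hn u x₀ (half_pos ho.radius_pos) (M - ω / 2) with hv | hv
      · exact ⟨_, _, upper u hum hcp htail _ _ _ _ ho hv⟩
      · have e3 : -(M - ω / 2) = -m - ω / 2 := by linarith [ho.width]
        rw [e3] at hv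
        have h := (upper (fun x => -u x) hum.neg hcm htail' _ _ _ _ ho.neg hv).neg
        simp only [neg_neg] at h
        exact ⟨_, _, h⟩
  intro j
  obtain ⟨m, M, ho⟩ := hall j
  exact ⟨m, M, ho.lower, ho.upper, ho.width, ho.near⟩

/-! ### Balls inside the domain -/

/-- The ball is connected and avoids the frontier, so it cannot leave `Ω`. -/
theorem ball_infDist_frontier_subset {Ω : Set (E n)} (hΩ : IsOpen Ω) {x₀ : E n} (hx₀ : x₀ ∈ Ω) :
    ball x₀ (infDist x₀ (frontier Ω)) ⊆ Ω := by
  set B := ball x₀ (infDist x₀ (frontier Ω)) with hB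
  have hdisj : ∀ x ∈ B, x ∉ frontier Ω := fun x hx hf => by
    have h1 := infDist_le_dist_of_mem (x := x₀) hf
    rw [hB, mem_ball, dist_comm] at hx
    linarith
  have hpre : IsPreconnected B := (convex_ball _ _).isPreconnected
  by_cases hpos : x₀ ∈ B
  · rcases isPreconnected_iff_subset_of_disjoint.1 hpre Ω (closure Ω)ᶜ hΩ
      isClosed_closure.isOpen_compl (fun x hx => by
        by_cases hxc : x ∈ closure Ω
        · refine Or.inl (by_contra fun hxΩ => hdisj x hx ?_)
          rw [hΩ.frontier_eq]
          exact ⟨hxc, hxΩ⟩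
        · exact Or.inr hxc) (by
        refine eq_empty_of_forall_notMem fun x hx => ?_
        exact hx.2.2 (subset_closure hx.2.1)) with h | h
    · exact h
    · exact absurd (subset_closure hx₀) (h hpos)
  · have : ¬ 0 < infDist x₀ (frontier Ω) := fun h => hpos (mem_ball_self h)
    rw [hB, ball_eq_empty.2 (not_lt.1 this)]
    exact empty_subset _

/-- Boundedness makes the frontier nonempty; for an empty frontier `infDist` would take its default
value `0`. -/
theorem infDist_frontier_pos (hn : 1 ≤ n) {Ω : Set (E n)} (hΩ : IsOpen Ω)
    (hb : Bornology.IsBounded Ω) {x₀ : E n} (hx₀ : x₀ ∈ Ω) : 0 < infDist x₀ (frontier Ω) := by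
  have : Nonempty (Fin n) := ⟨⟨0, hn⟩⟩
  have hne : (frontier Ω).Nonempty := by
    refine nonempty_frontier_iff.2 ⟨⟨x₀, hx₀⟩, ?_⟩
    rintro rfl
    exact NormedSpace.unbounded_univ ℝ (E n) hb
  refine (isClosed_frontier.notMem_iff_infDist_pos hne).1 fun h => ?_
  rw [hΩ.frontier_eq] at h
  exact h.2 hx₀

/-! ### The precise representative and Hölder continuity -/

/-- The representative of `w` given by the upper limit of its averages on small balls. -/
def preciseRep (w : E n → ℝ) (x : E n) : ℝ :=
  Filter.limsup (fun i : ℕ => ⨍ y in closedBall x (1 / ((i : ℝ) + 1)), w y) Filter.atTop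

theorem preciseRep_ae_eq {w : E n → ℝ} (hw : LocallyIntegrable w volume) :
    preciseRep w =ᵐ[volume] w := by
  filter_upwards [IsUnifLocDoublingMeasure.ae_tendsto_average volume hw 1] with x hx
  refine (hx (fun _ => x) (fun i : ℕ => 1 / ((i : ℝ) + 1)) (l := Filter.atTop) ?_ ?_).limsup_eq
  · exact tendsto_nhdsWithin_iff.2 ⟨tendsto_one_div_add_atTop_nhds_zero_nat,
      .of_forall fun i => mem_Ioi.2 (by positivity)⟩
  · exact .of_forall fun i => mem_closedBall_self (by positivity)

/-- Small averages stay in the closed convex set `[m, M]`. The conclusion holds at every point, not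
merely almost everywhere, so oscillation bounds on balls become pointwise bounds. -/
theorem preciseRep_mem_Icc {w : E n → ℝ} (hw : LocallyIntegrable w volume) {x : E n}
    {U : Set (E n)} (hU : IsOpen U) (hx : x ∈ U) {m M : ℝ}
    (h : ∀ᵐ y ∂volume.restrict U, m ≤ w y ∧ w y ≤ M) : preciseRep w x ∈ Icc m M := by
  obtain ⟨ε, hε, hεU⟩ := Metric.isOpen_iff.1 hU x hx
  have hlim := (tendsto_one_div_add_atTop_nhds_zero_nat (𝕜 := ℝ)).eventually (gt_mem_nhds hε)
  have hev : ∀ᶠ i : ℕ in Filter.atTop,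
      (⨍ y in closedBall x (1 / ((i : ℝ) + 1)), w y) ∈ Icc m M := by
    filter_upwards [hlim] with i hi
    have hi0 : 0 < 1 / ((i : ℝ) + 1) := by positivity
    refine (convex_Icc m M).set_average_mem isClosed_Icc
      (measure_closedBall_pos _ _ hi0).ne' measure_closedBall_lt_top.ne ?_
      (hw.integrableOn_isCompact (isCompact_closedBall _ _))
    exact ae_restrict_of_ae_restrict_of_subset
      ((closedBall_subset_ball hi).trans hεU) h
  have hle : ∀ᶠ i : ℕ in Filter.atTop,
      (⨍ y in closedBall x (1 / ((i : ℝ) + 1)), w y) ≤ M := hev.mono fun i hi => hi.2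
  have hge : ∀ᶠ i : ℕ in Filter.atTop,
      m ≤ ⨍ y in closedBall x (1 / ((i : ℝ) + 1)), w y := hev.mono fun i hi => hi.1
  have hb : Filter.IsBoundedUnder (· ≤ ·) Filter.atTop
      fun i : ℕ => ⨍ y in closedBall x (1 / ((i : ℝ) + 1)), w y := ⟨M, by simpa using hle⟩
  have hb' : Filter.IsBoundedUnder (· ≥ ·) Filter.atTop
      fun i : ℕ => ⨍ y in closedBall x (1 / ((i : ℝ) + 1)), w y := ⟨m, by simpa using hge⟩
  refine ⟨Filter.le_limsup_of_frequently_le hge.frequently hb,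
    Filter.limsup_le_of_le hb'.isCoboundedUnder_le hle⟩

/-- Oscillation decay at every point of a set makes the precise representative Hölder. -/
theorem abs_preciseRep_sub_le {w : E n → ℝ} (hw : LocallyIntegrable w volume) {S : Set (E n)}
    {α κ L R : ℝ} (hα : 0 < α) (hκ : 0 < κ) (hL : 0 < L) (hR : 0 < R)
    (h : ∀ x ∈ S, ∀ j : ℕ, ∃ m M : ℝ, -L ≤ m ∧ M ≤ L ∧ M - m = (4 ^ (-α)) ^ j * (2 * L) ∧
        ∀ᵐ y ∂volume.restrict (ball x (κ * R / 4 ^ j)), m ≤ w y ∧ w y ≤ M)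
    {x y : E n} (hx : x ∈ S) (hy : y ∈ S) :
    |preciseRep w x - preciseRep w y| ≤ 2 * L * (16 / κ) ^ α * (‖x - y‖ / R) ^ α := by
  have hbd : ∀ z ∈ S, |preciseRep w z| ≤ L := fun z hz => by
    obtain ⟨m, M, hm, hM, -, hae⟩ := h z hz 0
    have := preciseRep_mem_Icc hw isOpen_ball (mem_ball_self (by positivity)) hae
    exact abs_le.2 ⟨hm.trans this.1, this.2.trans hM⟩
  rw [mul_assoc, ← Real.mul_rpow (by positivity) (by positivity)]
  set t : ℝ := ‖x - y‖ / (κ * R) with ht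
  have e : 16 / κ * (‖x - y‖ / R) = 16 * t := by rw [ht]; field_simp
  rw [e]
  rcases (norm_nonneg (x - y)).eq_or_lt with h0 | h0
  · have : x = y := sub_eq_zero.1 (norm_eq_zero.1 h0.symm)
    rw [this, sub_self, abs_zero]; positivity
  have ht0 : 0 < t := by positivity
  -- Distant points need only the bound `2L`. For close ones `j` is chosen with `4^{-(j+1)} < 4t ≤
  -- 4^{-j}`, so that `y` lies in the `j`-th ball around `x` and `4^{-j} < 16t`.
  rcases le_or_gt (1 / 4) t with h4 | h4
  · have h1 : 1 ≤ (16 * t) ^ α := Real.one_le_rpow (by linarith) hα.le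
    have h2 := abs_le.1 (hbd x hx)
    have h3 := abs_le.1 (hbd y hy)
    calc _ ≤ 2 * L := abs_le.2 ⟨by linarith, by linarith⟩
      _ ≤ _ := le_mul_of_one_le_right (by positivity) h1
  · obtain ⟨j, hj1, hj2⟩ := exists_nat_pow_near_of_lt_one (x := 4 * t) (y := 1 / 4)
      (by positivity) (by linarith) (by norm_num) (by norm_num)
    obtain ⟨m, M, -, -, hw', hae⟩ := h x hx j
    have hq : (0 : ℝ) < (1 / 4) ^ j := by positivity
    have hyx : y ∈ ball x (κ * R / 4 ^ j) := by
      rw [mem_ball, dist_comm, dist_eq_norm]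
      have h1 : ‖x - y‖ = t * (κ * R) := by rw [ht]; field_simp
      rw [h1, show κ * R / 4 ^ j = (1 / 4) ^ j * (κ * R) by rw [one_div_pow]; field_simp]
      gcongr
      linarith
    have h2 := preciseRep_mem_Icc hw isOpen_ball (mem_ball_self (by positivity)) hae
    have h3 := preciseRep_mem_Icc hw isOpen_ball hyx hae
    have h4 : ((4 : ℝ) ^ (-α)) ^ j ≤ (16 * t) ^ α := by
      have : ((4 : ℝ) ^ (-α)) ^ j = ((1 / 4 : ℝ) ^ j) ^ α := by
        rw [← Real.rpow_natCast, ← Real.rpow_natCast, ← Real.rpow_mul (by norm_num),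
          ← Real.rpow_mul (by norm_num), Real.div_rpow (by norm_num) (by norm_num), Real.one_rpow,
          one_div, ← Real.rpow_neg (by norm_num)]
        congr 1; ring
      rw [this]
      refine Real.rpow_le_rpow hq.le ?_ hα.le
      rw [pow_succ] at hj1
      linarith
    calc _ ≤ M - m := abs_le.2 ⟨by linarith [h2.1, h3.2], by linarith [h2.2, h3.1]⟩
      _ = 2 * L * (4 ^ (-α)) ^ j := by rw [hw']; ring
      _ ≤ _ := by gcongr

/-- Pairs closer than a Lebesgue number of the cover lie in a common ball; for the others
boundedness on `K` suffices. -/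
theorem locHolder_of_ball {v : E n → ℝ} {α : ℝ} (hα : 0 < α) {Ω : Set (E n)}
    (h : ∀ x ∈ Ω, ∃ R, 0 < R ∧ holderSeminorm α v (ball x R) < ∞) : LocHolder α v Ω := by
  intro K hKΩ hK
  choose! R hR hfin using h
  have hpt : ∀ (S : Set (E n)) (x y : E n), x ∈ S → y ∈ S →
      ENNReal.ofReal (|v x - v y| / ‖x - y‖ ^ α) ≤ holderSeminorm α v S := fun S x y hx hy =>
    le_iSup₂_of_le x hx (le_iSup₂_of_le y hy le_rfl)
  obtain ⟨b, hb⟩ : ∃ b : ℝ, ∀ y ∈ K, |v y| ≤ b := by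
    refine hK.induction_on (p := fun S => ∃ b : ℝ, ∀ y ∈ S, |v y| ≤ b) ⟨0, by simp⟩
      (fun S T hST ⟨b, hb⟩ => ⟨b, fun y hy => hb y (hST hy)⟩)
      (fun S T ⟨b, hb⟩ ⟨c, hc⟩ => ⟨max b c, fun y hy => hy.elim
        (fun h => (hb y h).trans (le_max_left _ _))
        (fun h => (hc y h).trans (le_max_right _ _))⟩) fun x hx => ?_
    have hxΩ := hKΩ hx
    refine ⟨ball x (R x), mem_nhdsWithin_of_mem_nhds (ball_mem_nhds x (hR x hxΩ)),
      |v x| + (holderSeminorm α v (ball x (R x))).toReal * R x ^ α, fun y hy => ?_⟩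
    have h1 := hpt _ y x hy (mem_ball_self (hR x hxΩ))
    have h2 := (ENNReal.ofReal_le_iff_le_toReal (hfin x hxΩ).ne).1 h1
    rcases (norm_nonneg (y - x)).eq_or_lt with h0 | h0
    · rw [sub_eq_zero.1 (norm_eq_zero.1 h0.symm)]
      have := (hR x hxΩ).le
      exact le_add_of_nonneg_right (by positivity)
    · rw [div_le_iff₀ (by positivity)] at h2
      have h3 : ‖y - x‖ ≤ R x := by rw [mem_ball, dist_eq_norm] at hy; exact hy.le
      have h4 : (holderSeminorm α v (ball x (R x))).toReal * ‖y - x‖ ^ α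
          ≤ (holderSeminorm α v (ball x (R x))).toReal * R x ^ α := by gcongr
      have h5 := abs_sub_abs_le_abs_sub (v y) (v x)
      linarith
  obtain ⟨t, htK, htc⟩ := hK.elim_nhds_subcover (fun x => ball x (R x))
    fun x hx => ball_mem_nhds x (hR x (hKΩ hx))
  obtain ⟨δ, hδ, hleb⟩ := lebesgue_number_lemma_of_metric (ι := t)
    (c := fun i => ball (i : E n) (R i)) hK (fun i => isOpen_ball)
    (by simpa [iUnion_subtype] using htc)
  have hsum : ∑ x ∈ t, holderSeminorm α v (ball x (R x)) < ∞ :=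
    ENNReal.sum_lt_top.2 fun x hx => hfin x (hKΩ (htK x hx))
  refine lt_of_le_of_lt (iSup₂_le fun x hx => iSup₂_le fun y hy => ?_)
    (ENNReal.add_lt_top.2 ⟨hsum, ENNReal.ofReal_lt_top (r := 2 * b / δ ^ α)⟩)
  by_cases hxy : ‖x - y‖ < δ
  · obtain ⟨i, hi⟩ := hleb x hx
    refine (hpt _ x y (hi (mem_ball_self hδ)) (hi ?_)).trans
      ((Finset.single_le_sum (f := fun x => holderSeminorm α v (ball x (R x)))
        (fun _ _ => zero_le) i.2).trans le_self_add)
    rwa [mem_ball, dist_comm, dist_eq_norm]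
  · refine le_trans (ENNReal.ofReal_le_ofReal ?_) le_add_self
    have h1 := abs_le.1 (hb x hx)
    have h2 := abs_le.1 (hb y hy)
    have h3 : |v x - v y| ≤ 2 * b := abs_le.2 ⟨by linarith, by linarith⟩
    have h4 : 0 ≤ b := by linarith
    have h5 := not_lt.1 hxy
    gcongr

/-! ### The quantitative estimate -/

/-- Comparison of tails at nearby centres for a function bounded on the larger ball. -/
theorem tailInt_le_of_center_mem (hs : 0 < s) (hp : 1 < p) {u : E n → ℝ} {x₀ x : E n} {R b τ : ℝ}
    (hR : 0 < R) (hb : 0 ≤ b) (hτ : 0 ≤ τ) (hx : x ∈ ball x₀ R)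
    (hu : ∀ᵐ y ∂volume.restrict (ball x₀ (2 * R)), |u y| ≤ b)
    (htail : tailInt s p u x₀ (2 * R) ≤ ENNReal.ofReal τ) :
    tailInt s p u x R ≤ ENNReal.ofReal
      (b ^ (p - 1) * kernelInt n s p * R ^ (-(s * p)) + 2 ^ ((n : ℝ) + s * p) * τ) := by
  have hp1 : 0 < p - 1 := by linarith
  have he : 0 ≤ (n : ℝ) + s * p := by positivity
  have hI := kernelInt_nonneg (n := n) (s := s) (p := p)
  have hsub : (ball x R)ᶜ ⊆ (ball x₀ (2 * R) ∩ (ball x R)ᶜ) ∪ (ball x₀ (2 * R))ᶜ := by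
    intro y hy
    by_cases h : y ∈ ball x₀ (2 * R)
    · exact Or.inl ⟨h, hy⟩
    · exact Or.inr h
  refine (lintegral_mono_set hsub).trans ((lintegral_union_le _ _ _).trans ?_)
  rw [ENNReal.ofReal_add (by positivity) (by positivity)]
  refine add_le_add ?_ ?_
  · rw [← tailInt_const hs hp hb x hR]
    refine le_trans ?_ (lintegral_mono_set (inter_subset_right (s := ball x₀ (2 * R))) :
      _ ≤ tailInt s p (fun _ => b) x R)
    refine setLIntegral_mono_ae' (measurableSet_ball.inter measurableSet_ball.compl) ?_
    filter_upwards [(ae_restrict_iff' measurableSet_ball).1 hu] with y hy hyS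
    refine ENNReal.ofReal_le_ofReal ?_
    have h1 := Real.rpow_le_rpow (abs_nonneg _) ((hy hyS.1).trans (le_abs_self b)) hp1.le
    gcongr
  · rw [ENNReal.ofReal_mul (by positivity)]
    refine le_trans ?_ (mul_le_mul_right htail _)
    rw [tailInt, ← lintegral_const_mul' _ _ ENNReal.ofReal_ne_top]
    refine setLIntegral_mono_ae' measurableSet_ball.compl (.of_forall fun y hy => ?_)
    have hy1 : 2 * R ≤ ‖y - x₀‖ := by simpa [dist_eq_norm] using hy
    have hx1 : ‖x - x₀‖ < R := by rwa [mem_ball, dist_eq_norm] at hx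
    have h2 : ‖y - x₀‖ ≤ ‖y - x‖ + ‖x - x₀‖ := norm_sub_le_norm_sub_add_norm_sub y x x₀
    have h3 : ‖y - x₀‖ ≤ 2 * ‖y - x‖ := by linarith
    have h4 : 0 < ‖y - x₀‖ := by linarith
    have h5 : 0 < ‖y - x‖ := by linarith
    rw [← ENNReal.ofReal_mul (by positivity)]
    refine ENNReal.ofReal_le_ofReal ?_
    rw [← mul_div_assoc, div_le_div_iff₀ (by positivity) (by positivity)]
    calc |u y| ^ (p - 1) * ‖y - x₀‖ ^ ((n : ℝ) + s * p)
        ≤ |u y| ^ (p - 1) * (2 * ‖y - x‖) ^ ((n : ℝ) + s * p) := by gcongr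
      _ = _ := by rw [Real.mul_rpow (by norm_num) h5.le]; ring

theorem tail_lt_top (hs : 0 < s) (hp : 1 < p) {u : E n → ℝ} (hu : MemWeightedL s p u) (x₀ : E n)
    {R : ℝ} (hR : 0 < R) : tail s p u x₀ R < ∞ :=
  ENNReal.rpow_lt_top_of_nonneg (one_div_nonneg.2 (by linarith))
    (ENNReal.mul_lt_top ENNReal.ofReal_lt_top (tailInt_lt_top hs hp hu.2 x₀ hR)).ne

theorem tail_congr {u v : E n → ℝ} (h : u =ᵐ[volume] v) (x₀ : E n) (R : ℝ) :
    tail s p u x₀ R = tail s p v x₀ R := by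
  have := tailInt_congr (s := s) (p := p) h x₀ R
  rw [tailInt, tailInt] at this
  rw [tail, tail, this]

theorem tailInt_eq_ofReal (hp : 1 < p) {u : E n → ℝ} {x₀ : E n} {R : ℝ} (hR : 0 < R)
    (h : tail s p u x₀ R ≠ ∞) : tailInt s p u x₀ R
      = ENNReal.ofReal ((tail s p u x₀ R).toReal ^ (p - 1) * R ^ (-(s * p))) := by
  have h1 := tail_rpow (s := s) hp u x₀ R
  rw [← ENNReal.ofReal_toReal h, ENNReal.ofReal_rpow_of_nonneg ENNReal.toReal_nonneg
    (by linarith)] at h1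
  rw [ENNReal.ofReal_mul (by positivity), h1, mul_right_comm, ← ENNReal.ofReal_mul (by positivity),
    ← Real.rpow_add hR, add_neg_cancel, Real.rpow_zero, ENNReal.ofReal_one, one_mul]

/-- The Hölder estimate for the precise representative. -/
theorem exists_holder_estimate (hn : 1 ≤ n) (hs : 0 < s) (hs1 : s < 1) (hp : 1 < p)
    (hH : 1 ≤ H) (hlam : 0 ≤ lam) :
    ∃ α C : ℝ, 0 < α ∧ α < 1 ∧ 1 ≤ C ∧ ∀ (d : ℝ), 0 ≤ d → ∀ (u w : E n → ℝ),
      Measurable u → LocallyIntegrable w volume → ∀ (x₀ : E n) (R : ℝ), 0 < R →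
      (∀ x ∈ ball x₀ R, Cacc s p d H lam u x R ∧ Cacc s p d H lam (fun y => -u y) x R) →
      (∀ x ∈ ball x₀ (2 * R), w x = u x) →
      holderSeminorm α (preciseRep w) (ball x₀ R) ≤ ENNReal.ofReal (C / R ^ α) *
        (eLpNorm u ∞ (volume.restrict (ball x₀ (2 * R))) + tail s p u x₀ (2 * R)
          + ENNReal.ofReal (R ^ ((lam + s * p) / p) * d)) := by
  obtain ⟨α, κ, hα, hα1, hκ, hκ1, hosc⟩ :=
    exists_oscillation_decay (n := n) (H := H) hn hs hs1 hp hH hlam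
  have hp0 : 0 < p := by linarith
  have hp1 : 0 < p - 1 := by linarith
  have hI := kernelInt_nonneg (n := n) (s := s) (p := p)
  -- The last two summands come from moving the centre of the tail; the `1` ensures `C₀ ≥ 1`, so
  -- that `C₀ S'` also dominates the supremum and the datum.
  set G : ℝ := 1 + kernelInt n s p + 2 ^ ((n : ℝ) + s * p) with hG
  have hG1 : 1 ≤ G := by
    have : (0 : ℝ) ≤ 2 ^ ((n : ℝ) + s * p) := by positivity
    rw [hG]; linarith
  set C₀ : ℝ := G ^ (1 / (p - 1)) with hC₀
  have hC₀1 : 1 ≤ C₀ := Real.one_le_rpow hG1 (by positivity)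
  have hC₀G : C₀ ^ (p - 1) = G := by
    rw [hC₀, ← Real.rpow_mul (by linarith), one_div_mul_cancel hp1.ne', Real.rpow_one]
  have hκα : 1 ≤ (16 / κ) ^ α := by
    refine Real.one_le_rpow ?_ hα.le
    rw [le_div_iff₀ hκ]; linarith
  set C : ℝ := 2 * C₀ * (16 / κ) ^ α with hC
  refine ⟨α, C, hα, hα1, by rw [hC]; nlinarith, ?_⟩
  intro d hd u w hum hw x₀ R hR hcacc hwu
  set S := eLpNorm u ∞ (volume.restrict (ball x₀ (2 * R))) + tail s p u x₀ (2 * R)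
      + ENNReal.ofReal (R ^ ((lam + s * p) / p) * d) with hS
  have hC0 : 0 < C := by rw [hC]; positivity
  rcases eq_or_ne S ∞ with hStop | hSfin
  · rw [hStop, ENNReal.mul_top (ENNReal.ofReal_pos.2 (by positivity)).ne']
    exact le_top
  set N := eLpNorm u ∞ (volume.restrict (ball x₀ (2 * R))) with hN
  have hNfin : N ≠ ∞ := fun h => hSfin (by rw [hS, h]; simp)
  have hTfin : tail s p u x₀ (2 * R) ≠ ∞ := fun h => hSfin (by rw [hS, h]; simp)
  set b := N.toReal with hb
  set T := (tail s p u x₀ (2 * R)).toReal with hT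
  have hSr : S.toReal = b + T + R ^ ((lam + s * p) / p) * d := by
    rw [hS, ENNReal.toReal_add (ENNReal.add_ne_top.2 ⟨hNfin, hTfin⟩) ENNReal.ofReal_ne_top,
      ENNReal.toReal_add hNfin hTfin, ENNReal.toReal_ofReal (by positivity)]
  have hb0 : 0 ≤ b := ENNReal.toReal_nonneg
  have hT0 : 0 ≤ T := ENNReal.toReal_nonneg
  have hD0 : 0 ≤ R ^ ((lam + s * p) / p) * d := by positivity
  have hub : ∀ᵐ y ∂volume.restrict (ball x₀ (2 * R)), |u y| ≤ b := by
    have h1 := ae_le_eLpNormEssSup (f := u) (μ := volume.restrict (ball x₀ (2 * R)))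
    rw [← eLpNorm_exponent_top] at h1
    filter_upwards [h1] with y hy
    rw [Real.enorm_eq_ofReal_abs] at hy
    exact (ENNReal.ofReal_le_iff_le_toReal hNfin).1 hy
  -- The oscillation decay needs a positive bound `L`, while the total `S` may vanish; hence the
  -- `ε`, removed at the end.
  have key : ∀ ε : ℝ, 0 < ε → ∀ x ∈ ball x₀ R, ∀ y ∈ ball x₀ R,
      |preciseRep w x - preciseRep w y|
        ≤ 2 * (C₀ * (S.toReal + ε)) * (16 / κ) ^ α * (‖x - y‖ / R) ^ α := by
    intro ε hε x hx y hy
    set S' := S.toReal + ε with hS'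
    have hS'0 : 0 < S' := by
      have : 0 ≤ S.toReal := ENNReal.toReal_nonneg
      linarith
    have hbS : b ≤ S' := by linarith
    have hTS : T ≤ S' := by linarith
    have hDS : R ^ ((lam + s * p) / p) * d ≤ S' := by linarith
    have hS'L : S' ≤ C₀ * S' := le_mul_of_one_le_left hS'0.le hC₀1
    refine abs_preciseRep_sub_le hw hα hκ (by positivity) hR (fun z hz j => ?_) hx hy
    have hsub : ball z R ⊆ ball x₀ (2 * R) := ball_subset_ball' (by
      have := mem_ball.1 hz
      linarith)
    have hdecay := hosc d hd u hum z R hR (hcacc z hz).1 (hcacc z hz).2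
      (C₀ * S') (by positivity) ?_ ?_ ?_ j
    · obtain ⟨m, M, h1, h2, h3, h4⟩ := hdecay
      refine ⟨m, M, h1, h2, h3, ?_⟩
      have hsub' : ball z (κ * R / 4 ^ j) ⊆ ball x₀ (2 * R) := by
        refine (ball_subset_ball ?_).trans hsub
        have h5 : κ * R ≤ R := mul_le_of_le_one_left hR.le hκ1
        exact (div_le_self (by positivity) (one_le_pow₀ (by norm_num))).trans h5
      filter_upwards [h4, ae_restrict_mem measurableSet_ball] with q hq hqm
      rwa [hwu q (hsub' hqm)]
    · filter_upwards [ae_restrict_of_ae_restrict_of_subset hsub hub] with q hq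
      linarith
    · have e : R ^ (lam + s * p) * d ^ p = (R ^ ((lam + s * p) / p) * d) ^ p := by
        rw [Real.mul_rpow (by positivity) hd, ← Real.rpow_mul hR.le, div_mul_cancel₀ _ hp0.ne']
      rw [e]
      exact Real.rpow_le_rpow hD0 (hDS.trans hS'L) hp0.le
    · refine (tailInt_le_of_center_mem hs hp hR hb0 (by positivity) hz hub
        (tailInt_eq_ofReal hp (by positivity) hTfin).le).trans (ENNReal.ofReal_le_ofReal ?_)
      have h1 : b ^ (p - 1) ≤ S' ^ (p - 1) := by gcongr
      have h2 : T ^ (p - 1) ≤ S' ^ (p - 1) := by gcongr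
      have h3 : (2 * R) ^ (-(s * p)) ≤ R ^ (-(s * p)) :=
        Real.rpow_le_rpow_of_nonpos hR (by linarith) (by nlinarith)
      rw [Real.mul_rpow (by linarith) hS'0.le, hC₀G]
      calc _ ≤ S' ^ (p - 1) * kernelInt n s p * R ^ (-(s * p))
            + 2 ^ ((n : ℝ) + s * p) * (S' ^ (p - 1) * R ^ (-(s * p))) := by gcongr
        _ = (kernelInt n s p + 2 ^ ((n : ℝ) + s * p)) * S' ^ (p - 1) * R ^ (-(s * p)) := by ring
        _ ≤ _ := by
          gcongr
          rw [hG]; linarith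
  refine iSup₂_le fun x hx => iSup₂_le fun y hy => ?_
  rw [← ENNReal.ofReal_toReal hSfin, ← ENNReal.ofReal_mul (by positivity)]
  refine ENNReal.ofReal_le_ofReal (le_of_forall_pos_le_add fun ε hε => ?_)
  set ε' := ε / (C / R ^ α) with hε'
  have hε'0 : 0 < ε' := by positivity
  have e1 : C / R ^ α * S.toReal + ε = C / R ^ α * (S.toReal + ε') := by
    rw [hε']; field_simp
  have hS0 : 0 ≤ S.toReal := ENNReal.toReal_nonneg
  rw [e1]
  rcases (norm_nonneg (x - y)).eq_or_lt with h0 | h0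
  · rw [← h0, Real.zero_rpow hα.ne', div_zero]; positivity
  · rw [div_le_iff₀ (by positivity)]
    refine (key ε' hε'0 x hx y hy).trans (le_of_eq ?_)
    rw [Real.div_rpow h0.le hR.le, hC]
    ring

end

end FracDG

/-! ### The theorem -/

theorem theorem2p3 (n : ℕ) (hn : 1 ≤ n) (s p H lam : ℝ) (hs₀ : 0 < s) (hs₁ : s < 1)
    (hp : 1 < p) (hsp : s * p < (n : ℝ)) (hH : 1 ≤ H) (hlam : 0 ≤ lam) :
    ∃ α C : ℝ, 0 < α ∧ α < 1 ∧ 1 ≤ C ∧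
      ∀ (Ω : Set (FracDG.E n)), IsOpen Ω → Bornology.IsBounded Ω →
      ∀ d : ℝ, 0 ≤ d → ∀ u ∈ FracDG.DG s p d H lam Ω,
        ∃ v : FracDG.E n → ℝ, v =ᵐ[volume.restrict Ω] u ∧ FracDG.LocHolder α v Ω ∧
          ∀ x₀ ∈ Ω, ∀ R : ℝ, 0 < R → R < infDist x₀ (frontier Ω) / 2 →
            FracDG.holderSeminorm α v (ball x₀ R) ≤
              ENNReal.ofReal (C / R ^ α) *
                (eLpNorm u ∞ (volume.restrict (ball x₀ (2 * R)))
                  + FracDG.tail s p u x₀ (2 * R)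
                  + ENNReal.ofReal (R ^ ((lam + s * p) / p) * d)) := by
  obtain ⟨α, C, hα, hα1, hC, hest⟩ :=
    FracDG.exists_holder_estimate (n := n) (H := H) hn hs₀ hs₁ hp hH hlam
  refine ⟨α, C, hα, hα1, hC, fun Ω hΩ hΩb d hd u hu => ?_⟩
  have hp0 : 0 < p := by linarith
  have hL := hu.1.1
  have hLp := hu.1.2.1.1
  set u' : FracDG.E n → ℝ := hL.1.mk u with hu'
  have hu'm : Measurable u' := hL.1.measurable_mk
  have hae : u =ᵐ[volume] u' := hL.1.ae_eq_mk
  have hcacc : ∀ x ∈ Ω, ∀ ρ < infDist x (frontier Ω), FracDG.Cacc s p d H lam u' x ρ ∧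
      FracDG.Cacc s p d H lam (fun y => -u' y) x ρ := fun x hx ρ hρ =>
    ⟨(FracDG.cacc_of_mem_DGPlus hp hu.1 hx hρ).congr hae,
      (FracDG.cacc_neg_of_mem_DGMinus hp hu.2 hx hρ).congr
        (by filter_upwards [hae] with y hy; rw [hy])⟩
  have hLp' : MemLp u' (ENNReal.ofReal p) (volume.restrict Ω) :=
    hLp.ae_eq (ae_restrict_of_ae hae)
  have : IsFiniteMeasure (volume.restrict Ω) := ⟨by
    rw [Measure.restrict_apply_univ]; exact hΩb.measure_lt_top⟩
  -- Outside `Ω` only `|u|^{p-1}` is known to be locally integrable, which for `p < 2` does not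
  -- suffice for averages; hence the cut-off.
  have hwi : LocallyIntegrable (Ω.indicator u') volume :=
    (IntegrableOn.integrable_indicator (hLp'.integrable (by simpa using hp.le))
      hΩ.measurableSet).locallyIntegrable
  have hbound : ∀ x₀ ∈ Ω, ∀ R : ℝ, 0 < R → R < infDist x₀ (frontier Ω) / 2 →
      FracDG.holderSeminorm α (FracDG.preciseRep (Ω.indicator u')) (ball x₀ R) ≤
        ENNReal.ofReal (C / R ^ α) *
          (eLpNorm u ∞ (volume.restrict (ball x₀ (2 * R)))
            + FracDG.tail s p u x₀ (2 * R)
            + ENNReal.ofReal (R ^ ((lam + s * p) / p) * d)) := by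
    intro x₀ hx₀ R hR hRd
    have hball := FracDG.ball_infDist_frontier_subset hΩ hx₀
    rw [eLpNorm_congr_ae (ae_restrict_of_ae hae), FracDG.tail_congr hae]
    refine hest d hd u' _ hu'm hwi x₀ R hR (fun x hx => ?_) fun x hx => ?_
    · have hx1 := mem_ball.1 hx
      refine hcacc x (hball (mem_ball.2 (by linarith))) R ?_
      have := infDist_le_infDist_add_dist (s := frontier Ω) (x := x₀) (y := x)
      rw [dist_comm] at this
      linarith
    · refine indicator_of_mem (hball ?_) _
      exact ball_subset_ball (by linarith) hx
  refine ⟨FracDG.preciseRep (Ω.indicator u'), ?_, FracDG.locHolder_of_ball hα fun x hx => ?_,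
    hbound⟩
  · filter_upwards [ae_restrict_of_ae (FracDG.preciseRep_ae_eq hwi), ae_restrict_of_ae hae,
      ae_restrict_mem hΩ.measurableSet] with x h1 h2 h3
    rw [h1, indicator_of_mem h3, h2]
  · have hpos := FracDG.infDist_frontier_pos hn hΩ hΩb hx
    set D := infDist x (frontier Ω) with hD
    -- The radius `D / 8` fits the local bounds: its double is `D / 4`, half of the radius `D / 2`
    -- on which the Caccioppoli inequalities are used.
    refine ⟨D / 8, by positivity, (hbound x hx (D / 8) (by positivity) (by linarith)).trans_lt ?_⟩
    have hc := hcacc x hx (D / 2) (by linarith)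
    have hlp : ∫⁻ y in ball x (D / 2), ENNReal.ofReal (|u' y| ^ p) < ∞ := by
      have h1 : eLpNorm (fun y => |u' y|) (ENNReal.ofReal p) (volume.restrict Ω) < ∞ :=
        hLp'.abs.2
      have h2 := FracDG.eLpNorm_rpow_of_nonneg hp (fun y => abs_nonneg (u' y)) Ω
      refine lt_of_le_of_lt (lintegral_mono_set ((ball_subset_ball (by linarith)).trans
        (FracDG.ball_infDist_frontier_subset hΩ hx))) ?_
      rw [← h2]
      exact ENNReal.rpow_lt_top_of_nonneg hp0.le h1.ne
    have htl : FracDG.tailInt s p u' x (D / 2 / 2) < ∞ :=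
      FracDG.tailInt_congr hae x _ ▸ FracDG.tailInt_lt_top hs₀ hp hL.2 x (by positivity)
    obtain ⟨K₁, hK₁⟩ := hc.1.exists_ae_le hn hs₀ hs₁ hp hH hlam hd hu'm (by positivity) htl hlp
    obtain ⟨K₂, hK₂⟩ := hc.2.exists_ae_le hn hs₀ hs₁ hp hH hlam hd
      (f := fun y => -u' y) hu'm.neg (by positivity)
      ((FracDG.tailInt_mono hp (fun y => (abs_neg _).le) x le_rfl).trans_lt htl)
      (by simpa only [abs_neg] using hlp)
    have hsup : eLpNorm u ∞ (volume.restrict (ball x (2 * (D / 8)))) < ∞ := by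
      rw [eLpNorm_congr_ae (ae_restrict_of_ae hae), eLpNorm_exponent_top,
        show 2 * (D / 8) = D / 2 / 2 by ring]
      refine eLpNormEssSup_lt_top_of_ae_bound (C := max K₁ K₂) ?_
      filter_upwards [hK₁, hK₂] with y h1 h2
      exact abs_le.2 ⟨by linarith [le_max_right K₁ K₂], h1.trans (le_max_left _ _)⟩
    exact ENNReal.mul_lt_top ENNReal.ofReal_lt_top (ENNReal.add_lt_top.2
      ⟨ENNReal.add_lt_top.2 ⟨hsup, FracDG.tail_lt_top hs₀ hp hL x (by positivity)⟩,
        ENNReal.ofReal_lt_top⟩)
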